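/- **Setting.** For integers $m,d\ge 0$ and $\sigma>0$, call a random matrix $P\in\mathbb{R}^{m\times d}$ a *$\sigma$-sub-Gaussian oblivious sketch* if its rows are $P_i^\top=\frac{1}{\sqrt m}W_i^\top$, where $W_1,\dots,W_m$ are i.i.d. random vectors in $\mathbb{R}^d$ with $\mathbb{E}[W_i]=0$, $\mathbb{E}[W_iW_i^\top]=I_d$ and $\mathbb{E}[\exp(t\,u^\top W_i)]\le\exp(\sigma^2t^2/2)$ for all $t\in\mathbb{R}$ and all unit vectors $u\in\mathbb{R}^d$. Let $M^\dagger$ denote the Moore–Penrose pseudoinverse (equal to $M^{-1}$ when $M$ is invertible). For a positive semidefinite $F$, a matrix $P$, and $\lambda\ge 0$, define the sketched influence $$\widetilde\tau_\lambda(g,g')=(Pg)^\top(PFP^\top+\lambda I)^{\dagger}(Pg').$$ **Theorem 7.** For every $\sigma>0$ there is a constant $C>0$, depending only on $\sigma$, such that the following holds. Let $A\in\mathbb{R}^{d_A\times d_A}$ and $E\in\mathbb{R}^{d_E\times d_E}$ be symmetric positive semidefinite, $F=A\otimes E$, $r_A=\operatorname{rank}(A)$, $r_E=\operatorname{rank}(E)$.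 Let $P=P_A\otimes P_E$, where $P_A\in\mathbb{R}^{m_A\times d_A}$ and $P_E\in\mathbb{R}^{m_E\times d_E}$ are $\sigma$-sub-Gaussian oblivious sketches defined on a common probability space. Let $a'_j\in\mathbb{R}^{d_A}$ and $e'_j\in\mathbb{R}^{d_E}$ ($j=1,\dots,k$) be fixed vectors and $g'_j=a'_j\otimes e'_j$. Let $a'_{j,\perp}$ be the component of $a'_j$ orthogonal to $\operatorname{range}(A)$, $e'_{j,\perp}$ the component of $e'_j$ orthogonal to $\operatorname{range}(E)$, and $g'_{j,\perp}$ the orthogonal projection of $g'_j$ onto $\ker(F)$. Put $$k_A=\#\{j: a'_{j,\perp}\ne 0\},\quad k_E=\#\{j: e'_{j,\perp}\neq 0\},\quad k_A'=\dim\operatorname{span}\{a'_{j,\perp}\}_{j=1}^k,\quad k_E'=\dim\operatorname{span}\{e'_{j,\perp}\}_{j=1}^k.$$ Let $\varepsilon,\delta\in(0,1)$ and assume $$m_A\ \ge\ C\,\frac{r_A+\min\{\log(\max\{k_A,1\}/\delta),\ k_A'+\log(1/\delta)\}}{\varepsilon^2},\qquad m_E\ \ge\ C\,\frac{r_E+\min\{\log(\max\{k_E,1\}/\delta),\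 k_E'+\log(1/\delta)\}}{\varepsilon^2}.$$ Then with probability at least $1-\delta$, the following bounds hold simultaneously for all $g\in\operatorname{range}(F)$ and all $j\in\{1,\dots,k\}$: * (unregularized) $\displaystyle |\widetilde\tau_0(g,g'_{j,\perp})|\le \varepsilon\,\frac{\|g\|_2\,\|g'_{j,\perp}\|_2}{\lambda_{\min}^+(F)}$, where $\lambda_{\min}^+(F)$ is the smallest non-zero eigenvalue of $F$ (if $F=0$, then $g=0$ and the bound is read as $0\le 0$); * (regularized) $\displaystyle |\widetilde\tau_\lambda(g,g'_{j,\perp})|\le \varepsilon\,\|g\|_2\,\|g'_{j,\perp}\|_2\left(\frac1\lambda+\frac{2\|F\|_2}{\lambda^2}\right)$ for every $\lambda>0$. -/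

import Mathlib

open MeasureTheory ProbabilityTheory
open scoped Matrix Kronecker NNReal ENNReal

namespace KronInfluence

/-! ### Moore-Penrose pseudoinverse of a real matrix -/

section Pseudoinverse

variable {m n : Type*} [Fintype m] [Fintype n]

/-- The four Penrose conditions: `X` is the Moore-Penrose pseudoinverse of `M`. -/
structure IsMoorePenrose (M : Matrix m n ℝ) (X : Matrix n m ℝ) : Prop where
  mul_mul_self : M * X * M = M
  self_mul_mul : X * M * X = X
  left_symm : (M * X)ᵀ = M * X
  right_symm : (X * M)ᵀ = X * M

theorem IsMoorePenrose.unique {M : Matrix m n ℝ} {X Y : Matrix n m ℝ}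
    (hX : IsMoorePenrose M X) (hY : IsMoorePenrose M Y) : X = Y := by
  have h1 : M * X = M * Y := by
    calc M * X = (M * X)ᵀ := hX.left_symm.symm
      _ = ((M * Y) * (M * X))ᵀ := by
          rw [← Matrix.mul_assoc, hY.mul_mul_self]
      _ = (M * X) * (M * Y) := by
          rw [Matrix.transpose_mul, hX.left_symm, hY.left_symm]
      _ = M * Y := by rw [← Matrix.mul_assoc, hX.mul_mul_self]
  have h2 : X * M = Y * M := by
    calc X * M = (X * M)ᵀ := hX.right_symm.symm
      _ = ((X * M) * (Y * M))ᵀ := by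
          rw [Matrix.mul_assoc, ← Matrix.mul_assoc M Y M, hY.mul_mul_self]
      _ = (Y * M) * (X * M) := by
          rw [Matrix.transpose_mul, hX.right_symm, hY.right_symm]
      _ = Y * M := by rw [Matrix.mul_assoc, ← Matrix.mul_assoc M X M, hX.mul_mul_self]
  calc X = X * M * X := hX.self_mul_mul.symm
    _ = Y * (M * X) := by rw [h2, Matrix.mul_assoc]
    _ = Y := by rw [h1, ← Matrix.mul_assoc, hY.self_mul_mul]

theorem exists_isMoorePenrose_of_symm {N : Matrix n n ℝ} (hN : Nᵀ = N) :
    ∃ S : Matrix n n ℝ, IsMoorePenrose N S ∧ Sᵀ = S := by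
  classical
  have hH : N.IsHermitian := by
    rw [Matrix.IsHermitian, Matrix.conjTranspose_eq_transpose_of_trivial, hN]
  obtain ⟨U, D, hU, hND⟩ : ∃ (U : Matrix n n ℝ) (D : n → ℝ),
      Uᵀ * U = 1 ∧ N = U * Matrix.diagonal D * Uᵀ := by
    refine ⟨hH.eigenvectorUnitary, hH.eigenvalues, ?_, ?_⟩
    · have h := Unitary.coe_star_mul_self hH.eigenvectorUnitary
      rwa [Matrix.star_eq_conjTranspose, Matrix.conjTranspose_eq_transpose_of_trivial] at h
    · have h := hH.spectral_theorem
      rw [Unitary.conjStarAlgAut_apply] at h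
      rw [Matrix.star_eq_conjTranspose, Matrix.conjTranspose_eq_transpose_of_trivial] at h
      simpa using h
  have key : ∀ a b : n → ℝ, (U * Matrix.diagonal a * Uᵀ) * (U * Matrix.diagonal b * Uᵀ)
      = U * Matrix.diagonal (fun i => a i * b i) * Uᵀ := by
    intro a b
    calc (U * Matrix.diagonal a * Uᵀ) * (U * Matrix.diagonal b * Uᵀ)
        = U * Matrix.diagonal a * (Uᵀ * U) * Matrix.diagonal b * Uᵀ := by
          simp only [Matrix.mul_assoc]
      _ = _ := by
          rw [hU, Matrix.mul_one, Matrix.mul_assoc U, Matrix.diagonal_mul_diagonal]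
  have symm : ∀ a : n → ℝ, (U * Matrix.diagonal a * Uᵀ)ᵀ = U * Matrix.diagonal a * Uᵀ := by
    intro a
    simp only [Matrix.transpose_mul, Matrix.transpose_transpose, Matrix.diagonal_transpose,
      Matrix.mul_assoc]
  refine ⟨U * Matrix.diagonal (fun i => (D i)⁻¹) * Uᵀ, ⟨?_, ?_, ?_, ?_⟩, symm _⟩
  · rw [hND, key, key]
    congr 3
    funext i
    exact mul_inv_mul_cancel (D i)
  · rw [hND, key, key]
    congr 3
    funext i
    by_cases h : D i = 0 <;> simp [h]
  · rw [hND, key, symm]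
  · rw [hND, key, symm]

theorem exists_isMoorePenrose (M : Matrix m n ℝ) : ∃ X, IsMoorePenrose M X := by
  obtain ⟨S, hS, hsymm⟩ := exists_isMoorePenrose_of_symm (N := Mᵀ * M) (by
    rw [Matrix.transpose_mul, Matrix.transpose_transpose])
  refine ⟨S * Mᵀ, ⟨?_, ?_, ?_, ?_⟩⟩
  · classical
    have h0 : Mᵀ * (M * S * (Mᵀ * M) - M) = 0 := by
      have h := hS.mul_mul_self
      simp only [Matrix.mul_assoc] at h
      rw [Matrix.mul_sub]
      simp only [Matrix.mul_assoc]
      rw [h, sub_self]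
    have h1 : (M * S * (Mᵀ * M) - M)ᴴ * (M * S * (Mᵀ * M) - M) = 0 := by
      rw [Matrix.conjTranspose_eq_transpose_of_trivial]
      have h3 : (M * S * (Mᵀ * M) - M)ᵀ = ((Mᵀ * M) * S - 1) * Mᵀ := by
        simp only [Matrix.transpose_sub, Matrix.transpose_mul, Matrix.transpose_transpose,
          hsymm, Matrix.sub_mul, Matrix.one_mul, Matrix.mul_assoc]
      rw [h3, Matrix.mul_assoc, h0, Matrix.mul_zero]
    have h2 := sub_eq_zero.mp (Matrix.conjTranspose_mul_self_eq_zero.mp h1)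
    simpa only [Matrix.mul_assoc] using h2
  · have h := hS.self_mul_mul
    calc S * Mᵀ * M * (S * Mᵀ) = (S * (Mᵀ * M) * S) * Mᵀ := by simp only [Matrix.mul_assoc]
      _ = S * Mᵀ := by rw [h]
  · simp only [Matrix.transpose_mul, Matrix.transpose_transpose, hsymm, Matrix.mul_assoc]
  · have h := hS.right_symm
    rwa [← Matrix.mul_assoc] at h

/-- The Moore-Penrose pseudoinverse `M†`. -/
noncomputable def pinv (M : Matrix m n ℝ) : Matrix n m ℝ :=
  (exists_isMoorePenrose M).choose

theorem pinv_spec (M : Matrix m n ℝ) : IsMoorePenrose M (pinv M) :=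
  (exists_isMoorePenrose M).choose_spec

/-- For an invertible matrix the pseudoinverse is the inverse. -/
theorem pinv_eq_inv [DecidableEq n] (M : Matrix n n ℝ) (hM : IsUnit M.det) : pinv M = M⁻¹ := by
  refine (pinv_spec M).unique ⟨?_, ?_, ?_, ?_⟩
  · rw [Matrix.mul_nonsing_inv M hM, Matrix.one_mul]
  · rw [Matrix.nonsing_inv_mul M hM, Matrix.one_mul]
  · rw [Matrix.mul_nonsing_inv M hM, Matrix.transpose_one]
  · rw [Matrix.nonsing_inv_mul M hM, Matrix.transpose_one]

end Pseudoinverse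

/-! ### Linear algebra -/

section LinearAlgebra

variable {ι κ : Type*} [Fintype ι] [Fintype κ] [DecidableEq ι] [DecidableEq κ]

/-- The range of a square matrix, as a subspace of Euclidean space. -/
noncomputable def rangeOf (M : Matrix ι ι ℝ) : Submodule ℝ (EuclideanSpace ℝ ι) :=
  LinearMap.range (Matrix.toEuclideanLin M)

/-- The kernel of a square matrix, as a subspace of Euclidean space. -/
noncomputable def kerOf (M : Matrix ι ι ℝ) : Submodule ℝ (EuclideanSpace ℝ ι) :=
  LinearMap.ker (Matrix.toEuclideanLin M)

/-- The spectral norm `‖M‖₂`. -/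
noncomputable def specNorm (M : Matrix ι ι ℝ) : ℝ :=
  ‖Matrix.toEuclideanCLM (n := ι) (𝕜 := ℝ) M‖

/-- The smallest non-zero eigenvalue of a positive semidefinite matrix `M ≠ 0`. -/
noncomputable def lamMinPos (M : Matrix ι ι ℝ) : ℝ :=
  sInf {x : ℝ | x ≠ 0 ∧ Module.End.HasEigenvalue (Matrix.toEuclideanLin M) x}

/-- The Kronecker product `a ⊗ e` of two vectors. -/
noncomputable def kronVec (a : EuclideanSpace ℝ ι) (e : EuclideanSpace ℝ κ) :
    EuclideanSpace ℝ (ι × κ) :=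
  WithLp.toLp 2 (fun p => a p.1 * e p.2)

/-- The component `v_⊥` of `v` orthogonal to `range M`. -/
noncomputable def perpPart (M : Matrix ι ι ℝ) (v : EuclideanSpace ℝ ι) : EuclideanSpace ℝ ι :=
  (rangeOf M)ᗮ.starProjection v

/-- The orthogonal projection of `v` onto `ker M`. -/
noncomputable def kerPart (M : Matrix ι ι ℝ) (v : EuclideanSpace ℝ ι) : EuclideanSpace ℝ ι :=
  (kerOf M).starProjection v

/-- The number of indices `j` for which `v j` has a non-zero component orthogonal to `range M`. -/
noncomputable def numOut {k : ℕ} (M : Matrix ι ι ℝ) (v : Fin k → EuclideanSpace ℝ ι) : ℕ :=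
  Nat.card {j : Fin k // perpPart M (v j) ≠ 0}

/-- The dimension of the span of the components of the `v j` orthogonal to `range M`. -/
noncomputable def dimOut {k : ℕ} (M : Matrix ι ι ℝ) (v : Fin k → EuclideanSpace ℝ ι) : ℕ :=
  Module.finrank ℝ (Submodule.span ℝ (Set.range fun j => perpPart M (v j)))

/-- The quantity `rank M + min {log (k / δ), k' + log (1 / δ)}`, where `k` is the number of
non-zero out-of-range components (replaced by `1` if there are none) and `k'` is the dimension
of their span. -/
noncomputable def sketchComplexity {k : ℕ} (M : Matrix ι ι ℝ) (v : Fin k → EuclideanSpace ℝ ι)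
    (δ : ℝ) : ℝ :=
  (M.rank : ℝ) + min (Real.log (max (numOut M v : ℝ) 1 / δ))
    ((dimOut M v : ℝ) + Real.log (1 / δ))

/-- The sketched influence `(Pg)ᵀ (P F Pᵀ + lam I)† (Pg')`, where `†` is the inverse if the
matrix is invertible (in particular if `F` is positive semidefinite and `lam > 0`). -/
noncomputable def sketchedInfluence (F : Matrix ι ι ℝ) (P : Matrix κ ι ℝ) (lam : ℝ)
    (g g' : EuclideanSpace ℝ ι) : ℝ :=
  (P *ᵥ g.ofLp) ⬝ᵥ (pinv (P * F * Pᵀ + lam • (1 : Matrix κ κ ℝ)) *ᵥ (P *ᵥ g'.ofLp))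

end LinearAlgebra

/-! ### Oblivious sub-Gaussian sketches -/

section Sketch

variable {Ω : Type*} [MeasurableSpace Ω]

/-- `W 1, …, W m` are i.i.d. random vectors in `ℝ^d` with mean zero, identity second moment
matrix, and all one-dimensional marginals along unit vectors sub-Gaussian with variance
proxy `σsq`. -/
structure IsSubGaussianRows {m d : ℕ} (σsq : ℝ≥0) (W : Fin m → Ω → EuclideanSpace ℝ (Fin d))
    (μ : Measure Ω) : Prop where
  indep : iIndepFun W μ
  identDistrib : ∀ i i', IdentDistrib (W i) (W i') μ μ
  mean_zero : ∀ i, ∫ ω, W i ω ∂μ = 0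
  isotropic : ∀ i a b, ∫ ω, W i ω a * W i ω b ∂μ = (1 : Matrix (Fin d) (Fin d) ℝ) a b
  subGaussian : ∀ i (u : EuclideanSpace ℝ (Fin d)), ‖u‖ = 1 →
    HasSubgaussianMGF (fun ω => inner ℝ u (W i ω)) σsq μ

/-- The sketching matrix with rows `(1 / √m) (W i)ᵀ`. -/
noncomputable def sketchMatrix {m d : ℕ} (W : Fin m → Ω → EuclideanSpace ℝ (Fin d)) (ω : Ω) :
    Matrix (Fin m) (Fin d) ℝ :=
  Matrix.of fun i a => (1 / √(m : ℝ)) * W i ω a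

end Sketch

end KronInfluence

open KronInfluence

namespace KronInfluence

/-! ### Exponential moments of squares of sub-Gaussian variables -/

/-! The argument is deterministic once each factor sketch nearly preserves inner products within the
range of its own matrix, and between that range and the vectors `perpPart`. No independence between
the two sketches is used: only a union bound.

Probability: squares of sub-Gaussian variables are sub-exponential, so Chernoff's method controls
the sketched norm of one vector. A half-net and polarization upgrade this to all inner products on a
subspace (`exists_subspace_embedding`). The minimum in `sketchComplexity` reflects two ways of using
this: one subspace range + line per nonzero out-of-range component, or a single subspace containing
all of them (`exists_factor_embedding`).

Tensor structure: the kernel part of `a ⊗ e` is a sum of three orthogonal simple tensors, each with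
at least one factor orthogonal to its range. That factor supplies the small constant. The left
vector is an arbitrary, not simple, element of range `F`; contracting it along one index at a time
reduces the product bound to the factors (`abs_kronecker_dotProduct_kronVec_le`). No embedding of
the full space range `F`, of dimension `r_A r_E`, is sampled.

Influence: with `w = (P F Pᵀ + lam I)† P g'` and `y = F Pᵀ w`, the vector `y` lies in range `F`,
where `P` is well behaved. Testing the equation for `w` against `y` shows that `y` is of size `ε
‖g'‖`, up to spectral factors, and the influence is then read off from `y`. -/

theorem exp_le_one_add_add_sq_mul_exp_abs (z : ℝ) :
    Real.exp z ≤ 1 + z + z ^ 2 * Real.exp |z| := by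
  have h1 : 1 ≤ Real.exp |z| := Real.one_le_exp (abs_nonneg z)
  rcases le_or_gt |z| 1 with h | h
  · have := (abs_le.mp (Real.abs_exp_sub_one_sub_id_le h)).2
    nlinarith [sq_nonneg z]
  · rcases le_or_gt 0 z with hz | hz
    · rw [abs_of_nonneg hz] at h h1 ⊢
      nlinarith [mul_le_mul_of_nonneg_right (show 1 ≤ z ^ 2 by nlinarith) (Real.exp_pos z).le]
    · have h2 : Real.exp z ≤ 1 := Real.exp_le_one_iff.mpr hz.le
      rw [abs_of_neg hz] at h h1 ⊢
      nlinarith [mul_le_mul_of_nonneg_left h1 (sq_nonneg z)]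

/-- Against the Gaussian density the exponent becomes `-(1/(2v) - c/2) g²`, whose coefficient is
negative because `v c < 1`. -/
theorem lintegral_exp_sq_gaussianReal_lt_top (c v : ℝ≥0) (hv : v ≠ 0) (h : v * c < 1) :
    ∫⁻ g, ENNReal.ofReal (Real.exp (c * g ^ 2 / 2)) ∂(gaussianReal 0 v) < ∞ := by
  have hv0 : (0 : ℝ) < v := by positivity
  have h' : (v : ℝ) * c < 1 := by exact_mod_cast h
  rw [gaussianReal_of_var_ne_zero 0 hv, lintegral_withDensity_eq_lintegral_mul _
    (measurable_gaussianPDF 0 v) (by fun_prop)]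
  have hb : 0 < 1 / (2 * (v : ℝ)) - c / 2 := by
    have : 1 / (2 * (v : ℝ)) - c / 2 = (1 - v * c) / (2 * v) := by field_simp
    rw [this]; exact div_pos (by linarith) (by positivity)
  have hint := ((integrable_exp_neg_mul_sq hb).const_mul (√(2 * Real.pi * ↑v))⁻¹)
  refine lt_of_le_of_lt (le_of_eq ?_) hint.lintegral_lt_top
  refine lintegral_congr fun g => ?_
  rw [Pi.mul_apply, gaussianPDF, ← ENNReal.ofReal_mul (gaussianPDFReal_nonneg _ _ _),
    gaussianPDFReal_def, mul_assoc, ← Real.exp_add]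
  congr 3
  field_simp
  ring

/-- Gaussian linearization: `exp (v x² / 2)` is the moment generating function at `x` of a centred
Gaussian of variance `v`. Tonelli then leaves an exponential moment linear in `X`, to which the
sub-Gaussian bound applies. -/
theorem lintegral_exp_sq_le_of_hasSubgaussianMGF {Ω : Type*} [MeasurableSpace Ω]
    {μ : Measure Ω} [IsProbabilityMeasure μ] {X : Ω → ℝ} {c : ℝ≥0}
    (hX : HasSubgaussianMGF X c μ) (v : ℝ≥0) :
    ∫⁻ ω, ENNReal.ofReal (Real.exp (v * X ω ^ 2 / 2)) ∂μ
      ≤ ∫⁻ g, ENNReal.ofReal (Real.exp (c * g ^ 2 / 2)) ∂(gaussianReal 0 v) := by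
  have hmeas : AEMeasurable (Function.uncurry fun (ω : Ω) (g : ℝ) =>
      ENNReal.ofReal (Real.exp (X ω * g))) (μ.prod (gaussianReal 0 v)) :=
    (Real.measurable_exp.comp_aemeasurable
      (hX.aemeasurable.comp_fst.mul measurable_snd.aemeasurable)).ennreal_ofReal
  have h1 : ∀ ω, ENNReal.ofReal (Real.exp (v * X ω ^ 2 / 2))
      = ∫⁻ g, ENNReal.ofReal (Real.exp (X ω * g)) ∂(gaussianReal 0 v) := by
    intro ω
    rw [← ofReal_integral_eq_lintegral_ofReal (integrable_exp_mul_gaussianReal _)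
      (Filter.Eventually.of_forall fun _ => (Real.exp_pos _).le)]
    have := congrFun (mgf_id_gaussianReal (μ := 0) (v := v)) (X ω)
    simp only [mgf, id, zero_mul, zero_add] at this
    rw [this]
  calc _ = ∫⁻ ω, ∫⁻ g, ENNReal.ofReal (Real.exp (X ω * g)) ∂(gaussianReal 0 v) ∂μ :=
        lintegral_congr h1
    _ = ∫⁻ g, ∫⁻ ω, ENNReal.ofReal (Real.exp (X ω * g)) ∂μ ∂(gaussianReal 0 v) :=
        lintegral_lintegral_swap hmeas
    _ ≤ _ := by
        refine lintegral_mono fun g => ?_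
        have hi := hX.integrable_exp_mul g
        have hm := hX.mgf_le g
        simp only [mul_comm (X _) g]
        rw [← ofReal_integral_eq_lintegral_ofReal hi
          (Filter.Eventually.of_forall fun _ => (Real.exp_pos _).le)]
        exact ENNReal.ofReal_le_ofReal hm

/-- The centred square of a sub-Gaussian variable with unit second moment is sub-exponential. -/
theorem exists_mgf_sq_sub_one_le (c : ℝ≥0) :
    ∃ s₀ K : ℝ, 0 < s₀ ∧ 0 < K ∧ ∀ {Ω : Type*} [MeasurableSpace Ω] (μ : Measure Ω)
      [IsProbabilityMeasure μ] (X : Ω → ℝ), HasSubgaussianMGF X c μ →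
      ∫ ω, X ω ^ 2 ∂μ = 1 → ∀ s : ℝ, |s| ≤ s₀ →
        Integrable (fun ω => Real.exp (s * (X ω ^ 2 - 1))) μ ∧
        mgf (fun ω => X ω ^ 2 - 1) μ s ≤ Real.exp (K * s ^ 2) := by
  obtain ⟨v, hv, hvc⟩ : ∃ v : ℝ≥0, v ≠ 0 ∧ v * c < 1 := by
    refine ⟨(c + 1)⁻¹, by positivity, ?_⟩
    rw [inv_mul_lt_iff₀ (by positivity)]
    simp
  have hv0 : (0 : ℝ) < v := by positivity
  set G := (∫⁻ g, ENNReal.ofReal (Real.exp (c * g ^ 2 / 2)) ∂(gaussianReal 0 v)).toReal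
  have hG := lintegral_exp_sq_gaussianReal_lt_top c v hv hvc
  -- With this choice two factors `exp (s₀ |X² - 1|)`, one from the Taylor remainder and one
  -- absorbing `(X² - 1)²`, are together at most `exp (v/2) * exp (v X²/2)`.
  set s₀ : ℝ := v / 4 with hs₀
  have hs₀p : 0 < s₀ := by positivity
  set K₁ : ℝ := 2 / s₀ ^ 2 * Real.exp (v / 2) with hK₁
  have hK₁p : 0 < K₁ := by positivity
  have hG0 : 0 ≤ G := ENNReal.toReal_nonneg
  refine ⟨s₀, K₁ * (G + 1), hs₀p, by positivity, ?_⟩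
  intro Ω _ μ _ X hX hX2 s hs
  have hlin := lintegral_exp_sq_le_of_hasSubgaussianMGF hX v
  have hmeasX := hX.aemeasurable
  have hint : Integrable (fun ω => Real.exp (v * X ω ^ 2 / 2)) μ := by
    refine (lintegral_ofReal_ne_top_iff_integrable ?_ ?_).mp (hlin.trans_lt hG).ne
    · exact (Real.measurable_exp.comp_aemeasurable (by fun_prop)).aestronglyMeasurable
    · exact Filter.Eventually.of_forall fun _ => (Real.exp_pos _).le
  have hintle : ∫ ω, Real.exp (v * X ω ^ 2 / 2) ∂μ ≤ G := by
    rw [integral_eq_lintegral_of_nonneg_ae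
      (Filter.Eventually.of_forall fun _ => (Real.exp_pos _).le) hint.1]
    exact ENNReal.toReal_mono hG.ne hlin
  -- A non-integrable function would have integral `0`, not `1`.
  have hX2i : Integrable (fun ω => X ω ^ 2) μ := by
    by_contra h
    rw [integral_undef h] at hX2
    exact zero_ne_one hX2
  have hpt : ∀ ω, Real.exp (s * (X ω ^ 2 - 1))
      ≤ 1 + s * (X ω ^ 2 - 1) + s ^ 2 * K₁ * Real.exp (v * X ω ^ 2 / 2) := by
    intro ω
    set Z := X ω ^ 2 - 1 with hZ
    have hZabs : |Z| ≤ X ω ^ 2 + 1 := by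
      rw [abs_le]; constructor <;> nlinarith [sq_nonneg (X ω)]
    have h1 := exp_le_one_add_add_sq_mul_exp_abs (s * Z)
    have h2 : Real.exp |s * Z| ≤ Real.exp (s₀ * |Z|) := by
      rw [abs_mul]; gcongr
    have h3 : Z ^ 2 ≤ 2 / s₀ ^ 2 * Real.exp (s₀ * |Z|) := by
      have := Real.quadratic_le_exp_of_nonneg (x := s₀ * |Z|) (by positivity)
      rw [div_mul_eq_mul_div, le_div_iff₀ (by positivity)]
      have h4 : (s₀ * |Z|) ^ 2 = Z ^ 2 * s₀ ^ 2 := by rw [mul_pow, sq_abs]; ring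
      nlinarith [mul_nonneg hs₀p.le (abs_nonneg Z)]
    have h5 : Real.exp (s₀ * |Z|) * Real.exp (s₀ * |Z|)
        ≤ Real.exp (v / 2) * Real.exp (v * X ω ^ 2 / 2) := by
      rw [← Real.exp_add, ← Real.exp_add]
      apply Real.exp_le_exp.mpr
      have : s₀ * |Z| ≤ s₀ * (X ω ^ 2 + 1) := by gcongr
      rw [hs₀] at this ⊢
      linarith
    have h6 : (s * Z) ^ 2 * Real.exp |s * Z|
        ≤ s ^ 2 * K₁ * Real.exp (v * X ω ^ 2 / 2) := by
      calc (s * Z) ^ 2 * Real.exp |s * Z|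
          ≤ (s ^ 2 * (2 / s₀ ^ 2 * Real.exp (s₀ * |Z|))) * Real.exp (s₀ * |Z|) := by
            rw [mul_pow]; gcongr
        _ = s ^ 2 * (2 / s₀ ^ 2) * (Real.exp (s₀ * |Z|) * Real.exp (s₀ * |Z|)) := by ring
        _ ≤ s ^ 2 * (2 / s₀ ^ 2) * (Real.exp (v / 2) * Real.exp (v * X ω ^ 2 / 2)) := by
            gcongr
        _ = _ := by rw [hK₁]; ring
    linarith
  have hdom : Integrable (fun ω => 1 + s * (X ω ^ 2 - 1)
      + s ^ 2 * K₁ * Real.exp (v * X ω ^ 2 / 2)) μ :=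
    ((integrable_const _).add ((hX2i.sub (integrable_const _)).const_mul _)).add
      (hint.const_mul _)
  have hexp : Integrable (fun ω => Real.exp (s * (X ω ^ 2 - 1))) μ := by
    refine hdom.mono' ?_ (Filter.Eventually.of_forall fun ω => ?_)
    · exact (Real.measurable_exp.comp_aemeasurable (by fun_prop)).aestronglyMeasurable
    · rw [Real.norm_of_nonneg (Real.exp_pos _).le]; exact hpt ω
  refine ⟨hexp, ?_⟩
  have hI : ∫ ω, (1 + s * (X ω ^ 2 - 1) + s ^ 2 * K₁ * Real.exp (v * X ω ^ 2 / 2)) ∂μ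
      = 1 + s ^ 2 * K₁ * ∫ ω, Real.exp (v * X ω ^ 2 / 2) ∂μ := by
    have hZi : Integrable (fun ω => s * (X ω ^ 2 - 1)) μ :=
      (hX2i.sub (integrable_const _)).const_mul _
    have h1i : Integrable (fun ω => 1 + s * (X ω ^ 2 - 1)) μ := (integrable_const _).add hZi
    rw [integral_add h1i (hint.const_mul _), integral_add (integrable_const _) hZi,
      integral_const_mul, integral_const_mul, integral_sub hX2i (integrable_const _), hX2]
    simp
  calc mgf (fun ω => X ω ^ 2 - 1) μ s
      ≤ ∫ ω, (1 + s * (X ω ^ 2 - 1) + s ^ 2 * K₁ * Real.exp (v * X ω ^ 2 / 2)) ∂μ :=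
        integral_mono hexp hdom hpt
    _ = 1 + s ^ 2 * K₁ * ∫ ω, Real.exp (v * X ω ^ 2 / 2) ∂μ := hI
    _ ≤ K₁ * (G + 1) * s ^ 2 + 1 := by
        nlinarith [mul_le_mul_of_nonneg_left hintle (show 0 ≤ s ^ 2 * K₁ by positivity),
          show 0 ≤ s ^ 2 * K₁ by positivity]
    _ ≤ _ := Real.add_one_le_exp _

/-! ### Concentration of the sketched norm of a fixed vector -/

section Concentration

variable {Ω : Type*} {m d : ℕ} {c : ℝ≥0}
  {W : Fin m → Ω → EuclideanSpace ℝ (Fin d)}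

/-- Isotropy gives `∑ u_a²` after expanding the square. Exchanging sum and integral needs
coordinates in `L²`, which follows from sub-Gaussianity along the basis vectors. -/
theorem IsSubGaussianRows.integral_inner_sq [MeasurableSpace Ω] {μ : Measure Ω}
    (hW : IsSubGaussianRows c W μ) (i : Fin m)
    {u : EuclideanSpace ℝ (Fin d)} (hu : ‖u‖ = 1) : ∫ ω, (inner ℝ u (W i ω)) ^ 2 ∂μ = 1 := by
  have hmem : ∀ a, MemLp (fun ω => W i ω a) 2 μ := by
    intro a
    have h := (hW.subGaussian i (EuclideanSpace.single a 1) (by simp)).memLp 2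
    simpa [EuclideanSpace.inner_single_left] using h
  have hint : ∀ a b, Integrable (fun ω => W i ω a * W i ω b) μ :=
    fun a b => (hmem a).integrable_mul (hmem b)
  have hexp : ∀ ω, (inner ℝ u (W i ω)) ^ 2 = ∑ a, ∑ b, (u a * u b) * (W i ω a * W i ω b) := by
    intro ω
    rw [PiLp.inner_apply, sq, Finset.sum_mul_sum]
    refine Finset.sum_congr rfl fun a _ => Finset.sum_congr rfl fun b _ => ?_
    simp only [RCLike.inner_apply, conj_trivial]
    ring
  simp only [hexp]
  rw [integral_finsetSum _ fun a _ => integrable_finsetSum _ fun b _ => (hint a b).const_mul _]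
  have : ∀ a, ∫ ω, ∑ b, (u a * u b) * (W i ω a * W i ω b) ∂μ = u a ^ 2 := by
    intro a
    rw [integral_finsetSum _ fun b _ => (hint a b).const_mul _]
    simp only [integral_const_mul, hW.isotropic, Matrix.one_apply, mul_ite, mul_one, mul_zero,
      Finset.sum_ite_eq, Finset.mem_univ, if_true]
    ring
  simp only [this]
  have h := EuclideanSpace.real_norm_sq_eq u
  rw [hu] at h
  linarith

theorem sketchMatrix_mulVec_apply (z : EuclideanSpace ℝ (Fin d)) (ω : Ω) (i : Fin m) :
    (sketchMatrix W ω *ᵥ z.ofLp) i = 1 / √(m : ℝ) * inner ℝ z (W i ω) := by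
  simp only [sketchMatrix, Matrix.mulVec, dotProduct, Matrix.of_apply, PiLp.inner_apply,
    RCLike.inner_apply, conj_trivial, Finset.mul_sum]
  exact Finset.sum_congr rfl fun a _ => by ring

theorem sketchMatrix_mulVec_dotProduct_self (z : EuclideanSpace ℝ (Fin d)) (ω : Ω) :
    (sketchMatrix W ω *ᵥ z.ofLp) ⬝ᵥ (sketchMatrix W ω *ᵥ z.ofLp)
      = (1 / (m : ℝ)) * ∑ i, (inner ℝ z (W i ω)) ^ 2 := by
  simp only [dotProduct, sketchMatrix_mulVec_apply, Finset.mul_sum]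
  refine Finset.sum_congr rfl fun i _ => ?_
  have : 1 / √(m : ℝ) * (1 / √(m : ℝ)) = 1 / m := by
    rw [div_mul_div_comm, Real.mul_self_sqrt (by positivity), one_mul]
  rw [← this]; ring

end Concentration

/-- Bernstein's inequality for the sketched norm of a fixed vector. -/
theorem exists_measure_sketch_norm_deviation_le (c : ℝ≥0) :
    ∃ κ : ℝ, 0 < κ ∧ ∀ {Ω : Type*} [MeasurableSpace Ω] (μ : Measure Ω)
      [IsProbabilityMeasure μ] {m d : ℕ} (W : Fin m → Ω → EuclideanSpace ℝ (Fin d)),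
      IsSubGaussianRows c W μ → 0 < m → ∀ (z : EuclideanSpace ℝ (Fin d)) (t : ℝ),
      0 < t → t ≤ 1 →
      μ {ω | t * ‖z‖ ^ 2 < |(sketchMatrix W ω *ᵥ z.ofLp) ⬝ᵥ (sketchMatrix W ω *ᵥ z.ofLp)
          - ‖z‖ ^ 2|} ≤ ENNReal.ofReal (2 * Real.exp (-(κ * m * t ^ 2))) := by
  obtain ⟨s₀, K₀, hs₀, hK₀, hmgf⟩ := exists_mgf_sq_sub_one_le c
  -- The second entry keeps the Chernoff parameter `t / (2 K)` within `s₀` for every `t ≤ 1`.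
  set K := max K₀ (1 / (2 * s₀)) with hK
  have hKp : 0 < K := hK₀.trans_le (le_max_left _ _)
  refine ⟨1 / (4 * K), by positivity, ?_⟩
  intro Ω _ μ _ m d W hW hm z t ht ht1
  have hm0 : (0 : ℝ) < m := by exact_mod_cast hm
  rcases eq_or_ne z 0 with rfl | hz
  · simp
  have hzn : 0 < ‖z‖ := norm_pos_iff.mpr hz
  set u : EuclideanSpace ℝ (Fin d) := ‖z‖⁻¹ • z with hu
  have hun : ‖u‖ = 1 := by
    rw [hu, norm_smul, norm_inv, norm_norm, inv_mul_cancel₀ hzn.ne']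
  have hzu : z = ‖z‖ • u := by rw [hu, smul_smul, mul_inv_cancel₀ hzn.ne', one_smul]
  set Y : Fin m → Ω → ℝ := fun i ω => (inner ℝ u (W i ω)) ^ 2 - 1 with hY
  have hWm : ∀ i, AEMeasurable (W i) μ := fun i => (hW.identDistrib i i).aemeasurable_fst
  have hYm : ∀ i, AEMeasurable (Y i) μ := fun i =>
    (((hW.subGaussian i u hun).aemeasurable).pow_const 2).sub_const 1
  have hYind : iIndepFun Y μ :=
    hW.indep.comp (fun _ w => (inner ℝ u w) ^ 2 - 1) (fun _ => by fun_prop)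
  -- The minimizer of `-s t + K s²`, with value `-t² / (4 K)`.
  set s := t / (2 * K) with hs
  have hsp : 0 < s := by positivity
  have hss : s ≤ s₀ := by
    have h1 : 1 / (2 * s₀) ≤ K := le_max_right _ _
    rw [div_le_iff₀ (by positivity)] at h1
    rw [hs, div_le_iff₀ (by positivity)]
    linarith
  have hbound : ∀ r : ℝ, |r| ≤ s₀ → Integrable (fun ω => Real.exp (r * (∑ i, Y i) ω)) μ ∧
      mgf (∑ i, Y i) μ r ≤ Real.exp (m * (K * r ^ 2)) := by
    intro r hr
    have hprod := hYind.mgf_sum₀ (t := r) hYm Finset.univ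
    have hi := fun i => hmgf μ _ (hW.subGaussian i u hun) (hW.integral_inner_sq i hun) r hr
    -- Positivity of the product yields integrability of the exponential of the sum, since a
    -- non-integrable function would give the value `0`.
    have hpos : 0 < mgf (∑ i, Y i) μ r := by
      rw [hprod]
      exact Finset.prod_pos fun i _ => mgf_pos (hi i).1
    refine ⟨?_, ?_⟩
    · by_contra h
      rw [mgf, integral_undef h] at hpos
      exact lt_irrefl _ hpos
    · rw [hprod]
      calc ∏ i, mgf (Y i) μ r ≤ ∏ _i : Fin m, Real.exp (K * r ^ 2) := by
            refine Finset.prod_le_prod (fun i _ => mgf_nonneg) fun i _ => ?_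
            refine (hi i).2.trans (Real.exp_le_exp.mpr ?_)
            exact mul_le_mul_of_nonneg_right (le_max_left _ _) (sq_nonneg r)
        _ = _ := by
            rw [Finset.prod_const, Finset.card_univ, Fintype.card_fin, ← Real.exp_nat_mul]
  have hexpo : -s * (m * t) + m * (K * s ^ 2) = -(1 / (4 * K) * m * t ^ 2) := by
    rw [hs]; field_simp; ring
  have hup : μ.real {ω | m * t ≤ (∑ i, Y i) ω} ≤ Real.exp (-(1 / (4 * K) * m * t ^ 2)) := by
    obtain ⟨h1, h2⟩ := hbound s (by rwa [abs_of_pos hsp])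
    refine (measure_ge_le_exp_mul_mgf (m * t) hsp.le h1).trans ?_
    refine (mul_le_mul_of_nonneg_left h2 (Real.exp_pos _).le).trans ?_
    rw [← Real.exp_add, hexpo]
  have hlo : μ.real {ω | (∑ i, Y i) ω ≤ -(m * t)} ≤ Real.exp (-(1 / (4 * K) * m * t ^ 2)) := by
    obtain ⟨h1, h2⟩ := hbound (-s) (by rwa [abs_neg, abs_of_pos hsp])
    refine (measure_le_le_exp_mul_mgf (-(m * t)) (by linarith) h1).trans ?_
    refine (mul_le_mul_of_nonneg_left h2 (Real.exp_pos _).le).trans ?_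
    rw [← Real.exp_add, ← hexpo]
    apply le_of_eq; congr 1; ring
  have hsub : {ω | t * ‖z‖ ^ 2 < |(sketchMatrix W ω *ᵥ z.ofLp) ⬝ᵥ (sketchMatrix W ω *ᵥ z.ofLp)
          - ‖z‖ ^ 2|} ⊆ {ω | m * t ≤ (∑ i, Y i) ω} ∪ {ω | (∑ i, Y i) ω ≤ -(m * t)} := by
    intro ω hω
    have hdev : (sketchMatrix W ω *ᵥ z.ofLp) ⬝ᵥ (sketchMatrix W ω *ᵥ z.ofLp) - ‖z‖ ^ 2
        = ‖z‖ ^ 2 * ((∑ i, Y i) ω / m) := by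
      have hz2 : ∀ i, (inner ℝ z (W i ω)) ^ 2 = ‖z‖ ^ 2 * (inner ℝ u (W i ω)) ^ 2 := by
        intro i
        conv_lhs => rw [hzu, real_inner_smul_left]
        ring
      rw [sketchMatrix_mulVec_dotProduct_self, Finset.sum_apply]
      simp only [hz2, hY, Finset.sum_sub_distrib, ← Finset.mul_sum, Finset.sum_const,
        Finset.card_univ, Fintype.card_fin, nsmul_eq_mul, mul_one]
      field_simp
    rw [Set.mem_ofPred_eq, hdev, abs_mul, abs_of_pos (by positivity : 0 < ‖z‖ ^ 2), mul_comm,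
      mul_lt_mul_iff_right₀ (by positivity), abs_div, abs_of_pos hm0, lt_div_iff₀ hm0,
      lt_abs] at hω
    rcases hω with h | h
    · left; simp only [Set.mem_ofPred_eq]; linarith
    · right; simp only [Set.mem_ofPred_eq]; linarith
  have hreal : ∀ T : Set Ω, ∀ x : ℝ, μ.real T ≤ x → μ T ≤ ENNReal.ofReal x := fun T x h =>
    (ENNReal.le_ofReal_iff_toReal_le (measure_ne_top _ _)
      (measureReal_nonneg.trans h)).mpr h
  calc _ ≤ μ _ := measure_mono hsub
    _ ≤ _ := measure_union_le _ _
    _ ≤ ENNReal.ofReal _ + ENNReal.ofReal _ := add_le_add (hreal _ _ hup) (hreal _ _ hlo)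
    _ = _ := by
        rw [← ENNReal.ofReal_add (Real.exp_pos _).le (Real.exp_pos _).le, two_mul]

/-! ### Nets of the unit ball -/

section Net

variable {V : Type*} [NormedAddCommGroup V] [NormedSpace ℝ V] [FiniteDimensional ℝ V]

/-- The unit ball of an `r`-dimensional space has a `1/2`-net with at most `5 ^ r` points. -/
theorem exists_half_net (V : Type*) [NormedAddCommGroup V] [NormedSpace ℝ V]
    [FiniteDimensional ℝ V] :
    ∃ N : Finset V, N.card ≤ 5 ^ Module.finrank ℝ V ∧ (∀ x ∈ N, ‖x‖ ≤ 1) ∧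
      ∀ x : V, ‖x‖ ≤ 1 → ∃ y ∈ N, ‖x - y‖ ≤ 1 / 2 := by
  classical
  -- A `1`-separated subset of the ball of radius `2` has at most `5 ^ r` points. One of maximal
  -- size is a `1`-net of that ball; halving it gives the net wanted.
  set T : Set ℕ := {n | ∃ s : Finset V, s.card = n ∧ (∀ x ∈ s, ‖x‖ ≤ 2) ∧
    ∀ x ∈ s, ∀ y ∈ s, x ≠ y → 1 ≤ ‖x - y‖} with hT
  have hbdd : BddAbove T := by
    refine ⟨5 ^ Module.finrank ℝ V, ?_⟩
    rintro _ ⟨s, rfl, h1, h2⟩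
    exact Besicovitch.card_le_of_separated s h1 h2
  obtain ⟨s, hcard, h1, h2⟩ := Nat.sSup_mem (s := T) ⟨0, ∅, by simp⟩ hbdd
  have hcov : ∀ x : V, ‖x‖ ≤ 2 → ∃ y ∈ s, ‖x - y‖ ≤ 1 := by
    intro x hx
    by_contra! h
    have hxs : x ∉ s := fun hxs => by
      have := h x hxs
      simp at this
      linarith
    have : s.card + 1 ∈ T := by
      refine ⟨insert x s, Finset.card_insert_of_notMem hxs, ?_, ?_⟩
      · intro y hy
        rcases Finset.mem_insert.mp hy with rfl | hy
        · exact hx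
        · exact h1 y hy
      · intro y hy z hz hyz
        rcases Finset.mem_insert.mp hy with rfl | hy' <;>
          rcases Finset.mem_insert.mp hz with rfl | hz'
        · exact absurd rfl hyz
        · exact (h z hz').le
        · rw [norm_sub_rev]; exact (h y hy').le
        · exact h2 y hy' z hz' hyz
    have := le_csSup hbdd this
    omega
  refine ⟨s.image fun x => (1 / 2 : ℝ) • x, ?_, ?_, ?_⟩
  · exact Finset.card_image_le.trans (Besicovitch.card_le_of_separated s h1 h2)
  · intro x hx
    obtain ⟨y, hy, rfl⟩ := Finset.mem_image.mp hx
    rw [norm_smul]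
    have := h1 y hy
    norm_num
    linarith
  · intro x hx
    obtain ⟨y, hy, hxy⟩ := hcov ((2 : ℝ) • x) (by rw [norm_smul]; norm_num; linarith)
    refine ⟨_, Finset.mem_image_of_mem _ hy, ?_⟩
    have : x - (1 / 2 : ℝ) • y = (1 / 2 : ℝ) • ((2 : ℝ) • x - y) := by
      rw [smul_sub, smul_smul]; norm_num
    rw [this, norm_smul]
    norm_num
    linarith

/-- A linear functional bounded by `β` on a `1/2`-net is bounded by `2 * β` on the unit ball. -/
theorem abs_le_of_half_net {N : Set V} (hN : ∀ x : V, ‖x‖ ≤ 1 → ∃ y ∈ N, ‖x - y‖ ≤ 1 / 2)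
    (f : V →ₗ[ℝ] ℝ) {β : ℝ} (hf : ∀ y ∈ N, |f y| ≤ β) (x : V) : |f x| ≤ 2 * β * ‖x‖ := by
  set φ : V →L[ℝ] ℝ := f.toContinuousLinearMap
  have hφ : ∀ x, φ x = f x := fun _ => rfl
  have hβ : 0 ≤ β := by
    obtain ⟨y, hy, -⟩ := hN 0 (by simp)
    exact (abs_nonneg _).trans (hf y hy)
  -- The net error is charged to the norm itself; solving for it gives `‖φ‖ ≤ 2 β`.
  have h : ‖φ‖ ≤ β + ‖φ‖ / 2 := by
    refine φ.opNorm_le_of_unit_norm (by positivity) fun x hx => ?_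
    obtain ⟨y, hy, hxy⟩ := hN x hx.le
    have h1 : φ x = φ y + φ (x - y) := by rw [← map_add]; simp
    have h2 : ‖φ (x - y)‖ ≤ ‖φ‖ / 2 :=
      (φ.le_opNorm _).trans (by nlinarith [norm_nonneg φ])
    have h3 : ‖φ y‖ ≤ β := hf y hy
    rw [h1]
    exact (norm_add_le _ _).trans (by linarith)
  have h4 := φ.le_opNorm x
  rw [hφ, Real.norm_eq_abs] at h4
  refine h4.trans (mul_le_mul_of_nonneg_right (by linarith) (norm_nonneg _))

/-- A symmetric bilinear form whose quadratic form is at most `t * ‖z‖ ^ 2` at all sums and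
differences of points of a `1/2`-net of the unit ball is bounded by `8 * t`. -/
theorem abs_bilin_le_of_half_net {N : Set V} (hN1 : ∀ x ∈ N, ‖x‖ ≤ 1)
    (hN : ∀ x : V, ‖x‖ ≤ 1 → ∃ y ∈ N, ‖x - y‖ ≤ 1 / 2)
    (B : V →ₗ[ℝ] V →ₗ[ℝ] ℝ) (hB : ∀ x y, B x y = B y x) {t : ℝ} (ht : 0 ≤ t)
    (hadd : ∀ x ∈ N, ∀ y ∈ N, |B (x + y) (x + y)| ≤ t * ‖x + y‖ ^ 2)
    (hsub : ∀ x ∈ N, ∀ y ∈ N, |B (x - y) (x - y)| ≤ t * ‖x - y‖ ^ 2) (x y : V) :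
    |B x y| ≤ 8 * t * ‖x‖ * ‖y‖ := by
  -- Polarization: sums and differences have norm at most `2`, hence `(4 t + 4 t) / 4`. Passing from
  -- the net to the ball doubles the bound once per argument, whence `8 t`.
  have hpt : ∀ x ∈ N, ∀ y ∈ N, |B x y| ≤ 2 * t := by
    intro x hx y hy
    have hpol : B x y = (B (x + y) (x + y) - B (x - y) (x - y)) / 4 := by
      simp only [map_add, map_sub, LinearMap.add_apply, LinearMap.sub_apply, hB y x]
      ring
    have hn1 := hN1 x hx
    have hn2 := hN1 y hy
    have h1 : ‖x + y‖ ^ 2 ≤ 4 := by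
      have := norm_add_le x y
      nlinarith [norm_nonneg (x + y)]
    have h2 : ‖x - y‖ ^ 2 ≤ 4 := by
      have := norm_sub_le x y
      nlinarith [norm_nonneg (x - y)]
    have h3 := (hadd x hx y hy).trans (mul_le_mul_of_nonneg_left h1 ht)
    have h4 := (hsub x hx y hy).trans (mul_le_mul_of_nonneg_left h2 ht)
    rw [hpol, abs_le]
    rw [abs_le] at h3 h4
    constructor <;> linarith [h3.1, h3.2, h4.1, h4.2]
  have h1 : ∀ x ∈ N, ∀ y, |B x y| ≤ 2 * (2 * t) * ‖y‖ := fun x hx y =>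
    abs_le_of_half_net hN (B x) (hpt x hx) y
  have h2 := abs_le_of_half_net hN (B.flip y) (β := 2 * (2 * t) * ‖y‖)
    (fun x hx => h1 x hx y) x
  rw [LinearMap.flip_apply] at h2
  linarith

end Net

/-! ### Oblivious subspace embedding -/

/-- The sketch `P` preserves the inner product of `x` and `y` up to relative error `η`. -/
def PreservesInner {ι κ : Type*} [Fintype ι] [Fintype κ] (P : Matrix κ ι ℝ) (η : ℝ)
    (x y : EuclideanSpace ℝ ι) : Prop :=
  |(P *ᵥ x.ofLp) ⬝ᵥ (P *ᵥ y.ofLp) - inner ℝ x y| ≤ η * ‖x‖ * ‖y‖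

/-- The union bound over sums and differences of net points. The constant `256 = 4 * 64` undoes `(η
/ 8)²` and leaves an exponent of at least `4 (r + 1 + log (1/δ))`: this beats `25 ^ r ≤ exp (4 r)`
and the prefactor `4 ≤ exp 4`. -/
theorem card_union_bound_le {κ s η δ : ℝ} {r N : ℕ} (hκ : 0 < κ) (hδ : 0 < δ) (hδ1 : δ ≤ 1)
    (hN : N ≤ 5 ^ r) (hs : 256 / κ * (r + 1 + Real.log (1 / δ)) ≤ s * η ^ 2) :
    2 * (N : ℝ) ^ 2 * (2 * Real.exp (-(κ * s * (η / 8) ^ 2))) ≤ δ := by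
  have hL : 0 ≤ Real.log (1 / δ) := Real.log_nonneg (by rw [le_div_iff₀ hδ]; linarith)
  have h1 : 4 * (r + 1 + Real.log (1 / δ)) ≤ κ * s * (η / 8) ^ 2 := by
    have : κ * s * (η / 8) ^ 2 = κ / 64 * (s * η ^ 2) := by ring
    rw [this]
    refine le_trans (le_of_eq ?_) (mul_le_mul_of_nonneg_left hs (by positivity))
    field_simp
    ring
  have h25 : (25 : ℝ) ≤ Real.exp 4 := by
    have h : Real.exp 4 = Real.exp 1 ^ 4 := by rw [← Real.exp_nat_mul]; norm_num
    have h2 : (2.7 : ℝ) ≤ Real.exp 1 := by have := Real.exp_one_gt_d9; linarith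
    rw [h]
    calc (25 : ℝ) ≤ 2.7 ^ 4 := by norm_num
      _ ≤ _ := by gcongr
  have hN2 : (N : ℝ) ^ 2 ≤ Real.exp (4 * r) := by
    have h : (N : ℝ) ≤ 5 ^ r := by exact_mod_cast hN
    calc (N : ℝ) ^ 2 ≤ (5 ^ r) ^ 2 := by gcongr
      _ = 25 ^ r := by rw [← pow_mul, mul_comm, pow_mul]; norm_num
      _ ≤ Real.exp 4 ^ r := by gcongr
      _ = _ := by rw [← Real.exp_nat_mul, mul_comm]
  have hexp : Real.exp (-(κ * s * (η / 8) ^ 2))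
      ≤ Real.exp (-(4 * r)) * (Real.exp (-4) * δ) := by
    have hδe : δ = Real.exp (-Real.log (1 / δ)) := by
      rw [one_div, Real.log_inv, neg_neg, Real.exp_log hδ]
    conv_rhs => rw [hδe]
    rw [← Real.exp_add, ← Real.exp_add]
    exact Real.exp_le_exp.mpr (by linarith)
  calc 2 * (N : ℝ) ^ 2 * (2 * Real.exp (-(κ * s * (η / 8) ^ 2)))
      ≤ 2 * Real.exp (4 * r) * (2 * (Real.exp (-(4 * r)) * (Real.exp (-4) * δ))) := by gcongr
    _ = 4 * (Real.exp (4 * r) * Real.exp (-(4 * r))) * Real.exp (-4) * δ := by ring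
    _ = 4 / Real.exp 4 * δ := by
        rw [← Real.exp_add, add_neg_cancel, Real.exp_zero, Real.exp_neg, mul_one, div_eq_mul_inv]
    _ ≤ 1 * δ := by
        refine mul_le_mul_of_nonneg_right ?_ hδ.le
        rw [div_le_one (Real.exp_pos _)]
        linarith
    _ = δ := one_mul δ

/-- A sub-Gaussian sketch with `O((dim V + log (1 / δ)) / η ^ 2)` rows embeds `V` with
distortion `η`, with probability at least `1 - δ`. -/
theorem exists_subspace_embedding (c : ℝ≥0) :
    ∃ C : ℝ, 0 < C ∧ ∀ {Ω : Type*} [MeasurableSpace Ω] (μ : Measure Ω)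
      [IsProbabilityMeasure μ] {m d : ℕ} (W : Fin m → Ω → EuclideanSpace ℝ (Fin d)),
      IsSubGaussianRows c W μ → ∀ (V : Submodule ℝ (EuclideanSpace ℝ (Fin d))) (η δ : ℝ),
      0 < η → η ≤ 1 → 0 < δ → δ ≤ 1 →
      C * (Module.finrank ℝ V + 1 + Real.log (1 / δ)) ≤ m * η ^ 2 →
      μ {ω | ¬ ∀ x ∈ V, ∀ y ∈ V, PreservesInner (sketchMatrix W ω) η x y}
        ≤ ENNReal.ofReal δ := by
  obtain ⟨κ, hκ, htail⟩ := exists_measure_sketch_norm_deviation_le c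
  refine ⟨256 / κ, by positivity, ?_⟩
  intro Ω _ μ _ m d W hW V η δ hη hη1 hδ hδ1 hm
  have hL : 0 ≤ Real.log (1 / δ) := Real.log_nonneg (by rw [le_div_iff₀ hδ]; linarith)
  have hmpos : 0 < m := by
    rcases Nat.eq_zero_or_pos m with rfl | h
    · have : 0 < 256 / κ * (Module.finrank ℝ V + 1 + Real.log (1 / δ)) := by positivity
      rw [Nat.cast_zero, zero_mul] at hm
      linarith
    · exact h
  obtain ⟨N, hcard, hN1, hN⟩ := exists_half_net V
  -- The threshold `η / 8` compensates the factor `8` in `abs_bilin_le_of_half_net`.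
  set bad : EuclideanSpace ℝ (Fin d) → Set Ω := fun z =>
    {ω | η / 8 * ‖z‖ ^ 2 < |(sketchMatrix W ω *ᵥ z.ofLp) ⬝ᵥ (sketchMatrix W ω *ᵥ z.ofLp)
          - ‖z‖ ^ 2|} with hbad
  set p := ENNReal.ofReal (2 * Real.exp (-(κ * m * (η / 8) ^ 2))) with hp
  have hbadle : ∀ z, μ (bad z) ≤ p := fun z =>
    htail μ W hW hmpos z (η / 8) (by positivity) (by linarith)
  have hsub : {ω | ¬ ∀ x ∈ V, ∀ y ∈ V, PreservesInner (sketchMatrix W ω) η x y}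
      ⊆ ⋃ q ∈ N ×ˢ N, (bad (q.1 + q.2 : V) ∪ bad (q.1 - q.2 : V)) := by
    intro ω hω
    by_contra hcon
    apply hω
    simp only [Set.mem_iUnion, not_exists, Set.mem_union, not_or, hbad, Set.mem_ofPred_eq,
      not_lt, Finset.mem_product] at hcon
    set B : V →ₗ[ℝ] V →ₗ[ℝ] ℝ := LinearMap.mk₂ ℝ
      (fun x y => (sketchMatrix W ω *ᵥ x.1.ofLp) ⬝ᵥ (sketchMatrix W ω *ᵥ y.1.ofLp)
        - inner ℝ x.1 y.1)
      (by intro x x' y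
          simp [Matrix.mulVec_add, add_dotProduct, inner_add_left]; ring)
      (by intro r x y
          simp [Matrix.mulVec_smul, smul_dotProduct, real_inner_smul_left]; ring)
      (by intro x y y'
          simp [Matrix.mulVec_add, dotProduct_add, inner_add_right]; ring)
      (by intro r x y
          simp [Matrix.mulVec_smul, dotProduct_smul, real_inner_smul_right]; ring) with hBdef
    have hBapp : ∀ x y : V, B x y =
        (sketchMatrix W ω *ᵥ x.1.ofLp) ⬝ᵥ (sketchMatrix W ω *ᵥ y.1.ofLp)
          - inner ℝ x.1 y.1 := fun x y => rfl
    intro x hx y hy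
    have h := abs_bilin_le_of_half_net (N := (N : Set V)) hN1 hN B
      (by intro x y; rw [hBapp, hBapp, dotProduct_comm, real_inner_comm])
      (t := η / 8) (by positivity)
      (by
        intro x hx y hy
        rw [hBapp, real_inner_self_eq_norm_sq]
        exact (hcon (x, y) ⟨hx, hy⟩).1)
      (by
        intro x hx y hy
        rw [hBapp, real_inner_self_eq_norm_sq]
        exact (hcon (x, y) ⟨hx, hy⟩).2) ⟨x, hx⟩ ⟨y, hy⟩
    rw [hBapp] at h
    unfold PreservesInner
    refine h.trans (le_of_eq ?_)
    simp only [Submodule.coe_norm]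
    ring
  have hp2 : ∀ z z', μ (bad z ∪ bad z') ≤ p + p := fun z z' =>
    (measure_union_le _ _).trans (add_le_add (hbadle z) (hbadle z'))
  calc _ ≤ μ _ := measure_mono hsub
    _ ≤ ∑ q ∈ N ×ˢ N, μ (bad (q.1 + q.2 : V) ∪ bad (q.1 - q.2 : V)) :=
        measure_biUnion_finset_le _ _
    _ ≤ ∑ _q ∈ N ×ˢ N, (p + p) := Finset.sum_le_sum fun q _ => hp2 _ _
    _ = ENNReal.ofReal (2 * (N.card : ℝ) ^ 2
          * (2 * Real.exp (-(κ * m * (η / 8) ^ 2)))) := by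
        rw [Finset.sum_const, Finset.card_product, hp, ← ENNReal.ofReal_add (by positivity)
          (by positivity), nsmul_eq_mul, ← ENNReal.ofReal_natCast,
          ← ENNReal.ofReal_mul (by positivity)]
        congr 1
        push_cast
        ring
    _ ≤ ENNReal.ofReal δ :=
        ENNReal.ofReal_le_ofReal (card_union_bound_le hκ hδ hδ1 hcard hm)

/-! ### The embedding event for one factor -/

theorem finrank_rangeOf {ι : Type*} [Fintype ι] [DecidableEq ι] (M : Matrix ι ι ℝ) :
    Module.finrank ℝ (rangeOf M) = M.rank := by
  rw [Matrix.rank_eq_finrank_range_toLin M (EuclideanSpace.basisFun ι ℝ).toBasis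
    (EuclideanSpace.basisFun ι ℝ).toBasis]
  rfl

theorem finrank_sup_le {V : Type*} [AddCommGroup V] [Module ℝ V] [FiniteDimensional ℝ V]
    (S T : Submodule ℝ V) :
    Module.finrank ℝ (S ⊔ T : Submodule ℝ V) ≤ Module.finrank ℝ S + Module.finrank ℝ T := by
  have := Submodule.finrank_sup_add_finrank_inf_eq S T
  omega

/-- With the number of rows required of one factor, the sketch preserves, with probability at
least `1 - δ / 2`, all inner products of `range M` with itself and with the out-of-range
components of the `v j`. -/
theorem exists_factor_embedding (c : ℝ≥0) :
    ∃ C : ℝ, 0 < C ∧ ∀ {Ω : Type*} [MeasurableSpace Ω] (μ : Measure Ω)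
      [IsProbabilityMeasure μ] {m d k : ℕ} (W : Fin m → Ω → EuclideanSpace ℝ (Fin d)),
      IsSubGaussianRows c W μ → ∀ (M : Matrix (Fin d) (Fin d) ℝ)
      (v : Fin k → EuclideanSpace ℝ (Fin d)) (ε δ : ℝ),
      0 < ε → ε < 1 → 0 < δ → δ < 1 → 1 ≤ M.rank →
      C * (sketchComplexity M v δ / ε ^ 2) ≤ m →
      μ {ω | ¬ ∀ x ∈ rangeOf M,
          (∀ y ∈ rangeOf M, PreservesInner (sketchMatrix W ω) (ε / 8) x y) ∧
          ∀ j, PreservesInner (sketchMatrix W ω) (ε / 8) x (perpPart M (v j))}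
        ≤ ENNReal.ofReal (δ / 2) := by
  obtain ⟨C, hC, hemb⟩ := exists_subspace_embedding c
  -- Here `320 = 5 * 64`: the `64` comes from distortion `ε / 8`, and the `5` absorbs the additive
  -- constants of both cases below, which is possible because the rank is at least `1`.
  refine ⟨320 * C, by positivity, ?_⟩
  intro Ω _ μ _ m d k W hW M v ε δ hε hε1 hδ hδ1 hr hm
  have hr1 : (1 : ℝ) ≤ M.rank := by exact_mod_cast hr
  have hL : 0 ≤ Real.log (1 / δ) := Real.log_nonneg (by rw [le_div_iff₀ hδ]; linarith)
  have hm' : 5 * C * sketchComplexity M v δ ≤ m * (ε / 8) ^ 2 := by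
    rw [mul_div_assoc', div_le_iff₀ (by positivity)] at hm
    linarith
  have hlog2 : Real.log 2 ≤ 1 := by have := Real.log_two_lt_d9; linarith
  rcases le_total (Real.log (max (numOut M v : ℝ) 1 / δ))
    ((dimOut M v : ℝ) + Real.log (1 / δ)) with hmin | hmin
  · rw [sketchComplexity, min_eq_left hmin] at hm'
    set K : ℝ := max (numOut M v : ℝ) 1 with hK
    have hK1 : 1 ≤ K := le_max_right _ _
    have hLK : 0 ≤ Real.log (K / δ) := Real.log_nonneg (by rw [le_div_iff₀ hδ]; linarith)
    -- There are at most `numOut M v + 1 ≤ 2 K` subspaces, so the failure probabilities add up to at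
    -- most `δ / 2`.
    set δ' := δ / (4 * K) with hδ'
    have hδ'0 : 0 < δ' := by positivity
    have hδ'1 : δ' ≤ 1 := by rw [hδ', div_le_one (by positivity)]; linarith
    have hlogδ' : Real.log (1 / δ') ≤ 2 + Real.log (K / δ) := by
      have h1 : 1 / δ' = 2 * 2 * (K / δ) := by rw [hδ']; field_simp; norm_num
      rw [h1, Real.log_mul (by norm_num) (by positivity), Real.log_mul (by norm_num)
        (by norm_num)]
      linarith
    set J := {j : Fin k // perpPart M (v j) ≠ 0}
    -- The index `none` covers the range itself, which must be embedded even when `J` is empty.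
    set V : Option J → Submodule ℝ (EuclideanSpace ℝ (Fin d)) := fun o =>
      o.elim (rangeOf M) (fun j => rangeOf M ⊔ Submodule.span ℝ {perpPart M (v j.1)})
    have hVdim : ∀ o, (Module.finrank ℝ (V o) : ℝ) ≤ M.rank + 1 := by
      rintro (_ | j)
      · change (Module.finrank ℝ (rangeOf M) : ℝ) ≤ _
        rw [finrank_rangeOf]
        linarith
      · have h1 := finrank_sup_le (rangeOf M) (Submodule.span ℝ {perpPart M (v j.1)})
        rw [finrank_rangeOf] at h1
        have h2 := finrank_span_le_card (R := ℝ) ({perpPart M (v j.1)} : Set _)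
        simp only [Set.toFinset_singleton, Finset.card_singleton] at h2
        change (Module.finrank ℝ
          (rangeOf M ⊔ Submodule.span ℝ {perpPart M (v j.1)} : Submodule ℝ _) : ℝ) ≤ _
        exact_mod_cast h1.trans (Nat.add_le_add_left h2 _)
    have hVle : ∀ o, rangeOf M ≤ V o := by
      rintro (_ | j)
      · exact le_rfl
      · exact le_sup_left
    have hbound : ∀ o, μ {ω | ¬ ∀ x ∈ V o, ∀ y ∈ V o,
        PreservesInner (sketchMatrix W ω) (ε / 8) x y} ≤ ENNReal.ofReal δ' := by
      intro o
      refine hemb μ W hW (V o) (ε / 8) δ' (by positivity) (by linarith) hδ'0 hδ'1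
        (le_trans ?_ hm')
      rw [mul_comm 5 C, mul_assoc]
      refine mul_le_mul_of_nonneg_left ?_ hC.le
      have := hVdim o
      linarith
    have hsub : {ω | ¬ ∀ x ∈ rangeOf M,
          (∀ y ∈ rangeOf M, PreservesInner (sketchMatrix W ω) (ε / 8) x y) ∧
          ∀ j, PreservesInner (sketchMatrix W ω) (ε / 8) x (perpPart M (v j))} ⊆
        ⋃ o ∈ (Finset.univ : Finset (Option J)), {ω | ¬ ∀ x ∈ V o, ∀ y ∈ V o,
          PreservesInner (sketchMatrix W ω) (ε / 8) x y} := by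
      intro ω hω
      by_contra hcon
      apply hω
      simp only [Set.mem_iUnion, Set.mem_ofPred_eq, Finset.mem_univ, exists_prop, true_and,
        not_exists, not_not] at hcon
      intro x hx
      refine ⟨fun y hy => hcon none x hx y hy, fun j => ?_⟩
      by_cases hj : perpPart M (v j) = 0
      · simp [PreservesInner, hj]
      · exact hcon (some ⟨j, hj⟩) x (hVle _ hx) _
          (Submodule.mem_sup_right (Submodule.mem_span_singleton_self _))
    have hcardJ : (Fintype.card (Option J) : ℝ) ≤ 2 * K := by
      have h1 : Fintype.card J = numOut M v := by rw [numOut, Nat.card_eq_fintype_card]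
      rw [Fintype.card_option, h1]
      push_cast
      have := le_max_left (numOut M v : ℝ) 1
      linarith
    calc _ ≤ μ _ := measure_mono hsub
      _ ≤ ∑ o : Option J, _ := measure_biUnion_finset_le _ _
      _ ≤ ∑ _o : Option J, ENNReal.ofReal δ' := Finset.sum_le_sum fun o _ => hbound o
      _ = ENNReal.ofReal (Fintype.card (Option J) * δ') := by
          rw [Finset.sum_const, Finset.card_univ, nsmul_eq_mul, ← ENNReal.ofReal_natCast,
            ← ENNReal.ofReal_mul (by positivity)]
      _ ≤ ENNReal.ofReal (δ / 2) := by
          refine ENNReal.ofReal_le_ofReal ((mul_le_mul_of_nonneg_right hcardJ hδ'0.le).trans ?_)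
          rw [hδ']
          apply le_of_eq
          field_simp
          norm_num
  · rw [sketchComplexity, min_eq_right hmin] at hm'
    set T := Submodule.span ℝ (Set.range fun j => perpPart M (v j)) with hT
    have hdim : (Module.finrank ℝ (rangeOf M ⊔ T : Submodule ℝ _) : ℝ)
        ≤ M.rank + dimOut M v := by
      have h := finrank_sup_le (rangeOf M) T
      rw [finrank_rangeOf] at h
      exact_mod_cast h
    have hlog : Real.log (1 / (δ / 2)) ≤ 1 + Real.log (1 / δ) := by
      have h1 : 1 / (δ / 2) = 2 * (1 / δ) := by field_simp
      rw [h1, Real.log_mul (by norm_num) (by positivity)]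
      linarith
    have hd0 : (0 : ℝ) ≤ dimOut M v := by positivity
    refine (measure_mono ?_).trans (hemb μ W hW (rangeOf M ⊔ T) (ε / 8) (δ / 2) (by positivity)
      (by linarith) (by positivity) (by linarith) (le_trans ?_ hm'))
    · intro ω hω hcon
      apply hω
      intro x hx
      exact ⟨fun y hy => hcon x (Submodule.mem_sup_left hx) y (Submodule.mem_sup_left hy),
        fun j => hcon x (Submodule.mem_sup_left hx) _
          (Submodule.mem_sup_right (Submodule.subset_span ⟨j, rfl⟩))⟩
    · rw [mul_comm 5 C, mul_assoc]
      refine mul_le_mul_of_nonneg_left ?_ hC.le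
      linarith

/-! ### Kronecker products of sketches -/

section Kronecker

variable {ι κ μ ν : Type*} [Fintype ι] [Fintype κ]

/-- The slice `x (·, e)` of a vector indexed by pairs. -/
noncomputable def fstSlice (x : EuclideanSpace ℝ (ι × κ)) (e : κ) : EuclideanSpace ℝ ι :=
  WithLp.toLp 2 fun a => x (a, e)

/-- The slice `x (a, ·)` of a vector indexed by pairs. -/
noncomputable def sndSlice (x : EuclideanSpace ℝ (ι × κ)) (a : ι) : EuclideanSpace ℝ κ :=
  WithLp.toLp 2 fun e => x (a, e)

theorem sum_norm_fstSlice_sq (x : EuclideanSpace ℝ (ι × κ)) :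
    ∑ e, ‖fstSlice x e‖ ^ 2 = ‖x‖ ^ 2 := by
  simp only [EuclideanSpace.real_norm_sq_eq, Fintype.sum_prod_type, fstSlice]
  exact Finset.sum_comm

theorem sum_norm_sndSlice_sq (x : EuclideanSpace ℝ (ι × κ)) :
    ∑ a, ‖sndSlice x a‖ ^ 2 = ‖x‖ ^ 2 := by
  simp only [EuclideanSpace.real_norm_sq_eq, Fintype.sum_prod_type, sndSlice]

theorem dotProduct_self_eq_norm_sq (x : EuclideanSpace ℝ ι) : x.ofLp ⬝ᵥ x.ofLp = ‖x‖ ^ 2 := by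
  rw [EuclideanSpace.real_norm_sq_eq, dotProduct]
  exact Finset.sum_congr rfl fun i _ => (sq _).symm

theorem inner_eq_dotProduct (x y : EuclideanSpace ℝ ι) : inner ℝ x y = x.ofLp ⬝ᵥ y.ofLp := by
  rw [EuclideanSpace.inner_eq_star_dotProduct, star_trivial, dotProduct_comm]

theorem kronecker_mulVec_apply (P : Matrix μ ι ℝ) (Q : Matrix ν κ ℝ)
    (x : EuclideanSpace ℝ (ι × κ)) (i : μ) (j : ν) :
    ((P ⊗ₖ Q) *ᵥ x.ofLp) (i, j) = ∑ e, Q j e * (P *ᵥ (fstSlice x e).ofLp) i := by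
  simp only [Matrix.mulVec, dotProduct, Fintype.sum_prod_type, Matrix.kronecker_apply, fstSlice,
    Finset.mul_sum]
  rw [Finset.sum_comm]
  exact Finset.sum_congr rfl fun e _ => Finset.sum_congr rfl fun a _ => by ring

theorem kronecker_mulVec_kronVec (P : Matrix μ ι ℝ) (Q : Matrix ν κ ℝ)
    (u : EuclideanSpace ℝ ι) (v : EuclideanSpace ℝ κ) (i : μ) (j : ν) :
    ((P ⊗ₖ Q) *ᵥ (kronVec u v).ofLp) (i, j) = (P *ᵥ u.ofLp) i * (Q *ᵥ v.ofLp) j := by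
  simp only [Matrix.mulVec, dotProduct, Fintype.sum_prod_type, Matrix.kronecker_apply, kronVec,
    Finset.sum_mul_sum]
  exact Finset.sum_congr rfl fun a _ => Finset.sum_congr rfl fun e _ => by ring

theorem inner_kronVec (u u' : EuclideanSpace ℝ ι) (v v' : EuclideanSpace ℝ κ) :
    inner ℝ (kronVec u v) (kronVec u' v') = inner ℝ u u' * inner ℝ v v' := by
  simp only [PiLp.inner_apply, RCLike.inner_apply, conj_trivial, Fintype.sum_prod_type, kronVec,
    Finset.sum_mul_sum]
  exact Finset.sum_congr rfl fun a _ => Finset.sum_congr rfl fun e _ => by ring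

theorem norm_kronVec_sq (u : EuclideanSpace ℝ ι) (v : EuclideanSpace ℝ κ) :
    ‖kronVec u v‖ ^ 2 = ‖u‖ ^ 2 * ‖v‖ ^ 2 := by
  simp only [← real_inner_self_eq_norm_sq, inner_kronVec]

variable [Fintype μ] [Fintype ν]

/-- The squared norm of `(P ⊗ Q) x`, computed first along the second index. -/
theorem exists_kronecker_mulVec_norm_sq (P : Matrix μ ι ℝ) (Q : Matrix ν κ ℝ)
    (S : Submodule ℝ (EuclideanSpace ℝ ι)) (x : EuclideanSpace ℝ (ι × κ))
    (hx : ∀ e, fstSlice x e ∈ S) :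
    ∃ y : ν → EuclideanSpace ℝ ι, (∀ j, y j ∈ S) ∧
      ((P ⊗ₖ Q) *ᵥ x.ofLp) ⬝ᵥ ((P ⊗ₖ Q) *ᵥ x.ofLp)
        = ∑ j, (P *ᵥ (y j).ofLp) ⬝ᵥ (P *ᵥ (y j).ofLp) ∧
      ∑ j, ‖y j‖ ^ 2
        = ∑ a, (Q *ᵥ (sndSlice x a).ofLp) ⬝ᵥ (Q *ᵥ (sndSlice x a).ofLp) := by
  -- Reading `x` as a matrix `X`, the product `(P ⊗ Q) x` is `P X Qᵀ`; the `y j` are the columns of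
  -- `X Qᵀ`.
  refine ⟨fun j => ∑ e, Q j e • fstSlice x e,
    fun j => S.sum_mem fun e _ => S.smul_mem _ (hx e), ?_, ?_⟩
  · have h : ∀ i j, ((P ⊗ₖ Q) *ᵥ x.ofLp) (i, j)
        = (P *ᵥ (∑ e, Q j e • fstSlice x e).ofLp) i := by
      intro i j
      rw [kronecker_mulVec_apply, WithLp.ofLp_sum, Matrix.mulVec_sum, Finset.sum_apply]
      exact Finset.sum_congr rfl fun e _ => by
        rw [WithLp.ofLp_smul, Matrix.mulVec_smul, Pi.smul_apply, smul_eq_mul]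
    simp only [dotProduct, Fintype.sum_prod_type, h]
    exact Finset.sum_comm
  · simp only [EuclideanSpace.real_norm_sq_eq, dotProduct, ← sq]
    rw [Finset.sum_comm]
    refine Finset.sum_congr rfl fun a _ => Finset.sum_congr rfl fun j _ => ?_
    simp [Matrix.mulVec, dotProduct, fstSlice, sndSlice]

/-- The bound for `P` is applied to the columns of `X Qᵀ`, then the bound for `Q` to the rows of
`X`. -/
theorem kronecker_norm_sq_le {P : Matrix μ ι ℝ} {Q : Matrix ν κ ℝ}
    {S : Submodule ℝ (EuclideanSpace ℝ ι)} {T : Submodule ℝ (EuclideanSpace ℝ κ)} {b : ℝ}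
    (hb : 0 ≤ b)
    (hP : ∀ x ∈ S, (P *ᵥ x.ofLp) ⬝ᵥ (P *ᵥ x.ofLp) ≤ b * ‖x‖ ^ 2)
    (hQ : ∀ x ∈ T, (Q *ᵥ x.ofLp) ⬝ᵥ (Q *ᵥ x.ofLp) ≤ b * ‖x‖ ^ 2)
    {x : EuclideanSpace ℝ (ι × κ)} (hxS : ∀ e, fstSlice x e ∈ S) (hxT : ∀ a, sndSlice x a ∈ T) :
    ((P ⊗ₖ Q) *ᵥ x.ofLp) ⬝ᵥ ((P ⊗ₖ Q) *ᵥ x.ofLp) ≤ b ^ 2 * ‖x‖ ^ 2 := by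
  obtain ⟨y, hy, h1, h2⟩ := exists_kronecker_mulVec_norm_sq P Q S x hxS
  rw [h1]
  calc _ ≤ ∑ j, b * ‖y j‖ ^ 2 := Finset.sum_le_sum fun j _ => hP _ (hy j)
    _ ≤ b * ∑ a, b * ‖sndSlice x a‖ ^ 2 := by
        rw [← Finset.mul_sum, h2]
        exact mul_le_mul_of_nonneg_left (Finset.sum_le_sum fun a _ => hQ _ (hxT a)) hb
    _ = _ := by rw [← Finset.mul_sum, sum_norm_sndSlice_sq]; ring

theorem le_kronecker_norm_sq {P : Matrix μ ι ℝ} {Q : Matrix ν κ ℝ}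
    {S : Submodule ℝ (EuclideanSpace ℝ ι)} {T : Submodule ℝ (EuclideanSpace ℝ κ)} {b : ℝ}
    (hb : 0 ≤ b)
    (hP : ∀ x ∈ S, b * ‖x‖ ^ 2 ≤ (P *ᵥ x.ofLp) ⬝ᵥ (P *ᵥ x.ofLp))
    (hQ : ∀ x ∈ T, b * ‖x‖ ^ 2 ≤ (Q *ᵥ x.ofLp) ⬝ᵥ (Q *ᵥ x.ofLp))
    {x : EuclideanSpace ℝ (ι × κ)} (hxS : ∀ e, fstSlice x e ∈ S) (hxT : ∀ a, sndSlice x a ∈ T) :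
    b ^ 2 * ‖x‖ ^ 2 ≤ ((P ⊗ₖ Q) *ᵥ x.ofLp) ⬝ᵥ ((P ⊗ₖ Q) *ᵥ x.ofLp) := by
  obtain ⟨y, hy, h1, h2⟩ := exists_kronecker_mulVec_norm_sq P Q S x hxS
  rw [h1]
  calc b ^ 2 * ‖x‖ ^ 2 = b * ∑ a, b * ‖sndSlice x a‖ ^ 2 := by
        rw [← Finset.mul_sum, sum_norm_sndSlice_sq]; ring
    _ ≤ ∑ j, b * ‖y j‖ ^ 2 := by
        rw [← Finset.mul_sum (f := fun j => ‖y j‖ ^ 2), h2]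
        exact mul_le_mul_of_nonneg_left (Finset.sum_le_sum fun a _ => hQ _ (hxT a)) hb
    _ ≤ _ := Finset.sum_le_sum fun j _ => hP _ (hy j)

/-- Bounds on `⟪P x, P u⟫` and `⟪Q y, Q v⟫` multiply to a bound on
`⟪(P ⊗ Q) x, (P ⊗ Q) (u ⊗ v)⟫`, for arbitrary `x` whose slices lie in the given subspaces. -/
theorem abs_kronecker_dotProduct_kronVec_le {P : Matrix μ ι ℝ} {Q : Matrix ν κ ℝ}
    {S : Submodule ℝ (EuclideanSpace ℝ ι)} {T : Submodule ℝ (EuclideanSpace ℝ κ)}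
    {u : EuclideanSpace ℝ ι} {v : EuclideanSpace ℝ κ} {α β : ℝ} (hα : 0 ≤ α) (hβ : 0 ≤ β)
    (hP : ∀ x ∈ S, |(P *ᵥ x.ofLp) ⬝ᵥ (P *ᵥ u.ofLp)| ≤ α * ‖x‖ * ‖u‖)
    (hQ : ∀ x ∈ T, |(Q *ᵥ x.ofLp) ⬝ᵥ (Q *ᵥ v.ofLp)| ≤ β * ‖x‖ * ‖v‖)
    {x : EuclideanSpace ℝ (ι × κ)} (hxS : ∀ e, fstSlice x e ∈ S) (hxT : ∀ a, sndSlice x a ∈ T) :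
    |((P ⊗ₖ Q) *ᵥ x.ofLp) ⬝ᵥ ((P ⊗ₖ Q) *ᵥ (kronVec u v).ofLp)|
      ≤ α * β * ‖x‖ * (‖u‖ * ‖v‖) := by
  -- The contraction `t = Xᵀ Pᵀ P u` of the first index. It is a combination of the rows of `X`, so
  -- it lies in `T`, and the whole pairing equals `⟪Q t, Q v⟫`.
  set t : EuclideanSpace ℝ κ :=
    WithLp.toLp 2 fun e => (P *ᵥ (fstSlice x e).ofLp) ⬝ᵥ (P *ᵥ u.ofLp) with ht
  have htT : t ∈ T := by
    have : t = ∑ a, (Pᵀ *ᵥ (P *ᵥ u.ofLp)) a • sndSlice x a := by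
      ext e
      rw [WithLp.ofLp_sum, Finset.sum_apply]
      simp only [ht, WithLp.ofLp_smul, Pi.smul_apply, smul_eq_mul, sndSlice]
      rw [dotProduct_comm, Matrix.dotProduct_mulVec, Matrix.mulVec_transpose]
      rfl
    rw [this]
    exact T.sum_mem fun a _ => T.smul_mem _ (hxT a)
  have hnorm : ‖t‖ ≤ α * ‖u‖ * ‖x‖ := by
    refine le_of_sq_le_sq ?_ (by positivity)
    rw [EuclideanSpace.real_norm_sq_eq, mul_pow, ← sum_norm_fstSlice_sq, Finset.mul_sum]
    refine Finset.sum_le_sum fun e _ => ?_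
    rw [← mul_pow, ← sq_abs]
    refine pow_le_pow_left₀ (abs_nonneg _) ((hP _ (hxS e)).trans (le_of_eq (by ring))) 2
  have heq : ((P ⊗ₖ Q) *ᵥ x.ofLp) ⬝ᵥ ((P ⊗ₖ Q) *ᵥ (kronVec u v).ofLp)
      = (Q *ᵥ t.ofLp) ⬝ᵥ (Q *ᵥ v.ofLp) := by
    have hQt : ∀ j, (Q *ᵥ t.ofLp) j
        = ∑ i, (∑ e, Q j e * (P *ᵥ (fstSlice x e).ofLp) i) * (P *ᵥ u.ofLp) i := by
      intro j
      change ∑ e, Q j e * ∑ i, (P *ᵥ (fstSlice x e).ofLp) i * (P *ᵥ u.ofLp) i = _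
      simp only [Finset.mul_sum, Finset.sum_mul, mul_assoc]
      exact Finset.sum_comm
    rw [dotProduct, dotProduct, Fintype.sum_prod_type, Finset.sum_comm]
    refine Finset.sum_congr rfl fun j _ => ?_
    rw [hQt, Finset.sum_mul]
    refine Finset.sum_congr rfl fun i _ => ?_
    rw [kronecker_mulVec_apply, kronecker_mulVec_kronVec]
    ring
  rw [heq]
  calc _ ≤ β * ‖t‖ * ‖v‖ := hQ t htT
    _ ≤ β * (α * ‖u‖ * ‖x‖) * ‖v‖ := by gcongr
    _ = _ := by ring

end Kronecker

/-! ### Range and kernel of a Kronecker product -/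

section RangeKer

variable {ι κ : Type*} [Fintype ι] [Fintype κ] [DecidableEq ι] [DecidableEq κ]

theorem mem_rangeOf {M : Matrix ι ι ℝ} {x : EuclideanSpace ℝ ι} :
    x ∈ rangeOf M ↔ ∃ y : EuclideanSpace ℝ ι, M *ᵥ y.ofLp = x.ofLp := by
  rw [rangeOf, LinearMap.mem_range]
  refine exists_congr fun y => ⟨fun h => by rw [← h]; rfl, fun h => ?_⟩
  exact (WithLp.ofLp_injective 2) h

theorem mem_kerOf {M : Matrix ι ι ℝ} {x : EuclideanSpace ℝ ι} :
    x ∈ kerOf M ↔ M *ᵥ x.ofLp = 0 := by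
  rw [kerOf, LinearMap.mem_ker]
  exact ⟨fun h => congrArg WithLp.ofLp h, fun h => (WithLp.ofLp_injective 2) h⟩

theorem inner_eq_zero_of_mem_rangeOf_of_mem_kerOf {M : Matrix ι ι ℝ} (hM : Mᵀ = M)
    {x y : EuclideanSpace ℝ ι} (hx : x ∈ rangeOf M) (hy : y ∈ kerOf M) : inner ℝ x y = 0 := by
  obtain ⟨z, hz⟩ := mem_rangeOf.mp hx
  rw [mem_kerOf] at hy
  rw [inner_eq_dotProduct, ← hz, dotProduct_comm, Matrix.dotProduct_mulVec,
    ← Matrix.mulVec_transpose, hM, hy, zero_dotProduct]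

/-- Orthogonality to `M (M x)` reads `‖M x‖² = 0` by symmetry. -/
theorem mem_kerOf_of_mem_rangeOf_orthogonal {M : Matrix ι ι ℝ} (hM : Mᵀ = M)
    {x : EuclideanSpace ℝ ι} (hx : x ∈ (rangeOf M)ᗮ) : x ∈ kerOf M := by
  rw [mem_kerOf]
  have h : inner ℝ (WithLp.toLp 2 (M *ᵥ (M *ᵥ x.ofLp)) : EuclideanSpace ℝ ι) x = 0 :=
    (Submodule.mem_orthogonal _ _).mp hx _ (mem_rangeOf.mpr ⟨WithLp.toLp 2 (M *ᵥ x.ofLp), rfl⟩)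
  rw [inner_eq_dotProduct, dotProduct_comm, Matrix.dotProduct_mulVec,
    ← Matrix.mulVec_transpose, hM] at h
  exact dotProduct_self_eq_zero.mp h

theorem fstSlice_mem_rangeOf (A : Matrix ι ι ℝ) (E : Matrix κ κ ℝ)
    {x : EuclideanSpace ℝ (ι × κ)} (hx : x ∈ rangeOf (A ⊗ₖ E)) (e : κ) :
    fstSlice x e ∈ rangeOf A := by
  obtain ⟨y, hy⟩ := mem_rangeOf.mp hx
  refine mem_rangeOf.mpr ⟨∑ e', E e e' • fstSlice y e', ?_⟩
  funext a
  have : (fstSlice x e).ofLp a = ((A ⊗ₖ E) *ᵥ y.ofLp) (a, e) := by rw [hy]; rfl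
  rw [this, kronecker_mulVec_apply, WithLp.ofLp_sum, Matrix.mulVec_sum, Finset.sum_apply]
  exact Finset.sum_congr rfl fun e _ => by
    rw [WithLp.ofLp_smul, Matrix.mulVec_smul, Pi.smul_apply, smul_eq_mul]

theorem sndSlice_mem_rangeOf (A : Matrix ι ι ℝ) (E : Matrix κ κ ℝ)
    {x : EuclideanSpace ℝ (ι × κ)} (hx : x ∈ rangeOf (A ⊗ₖ E)) (a : ι) :
    sndSlice x a ∈ rangeOf E := by
  obtain ⟨y, hy⟩ := mem_rangeOf.mp hx
  refine mem_rangeOf.mpr ⟨∑ a', A a a' • sndSlice y a', ?_⟩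
  funext e
  have : (sndSlice x a).ofLp e = ((A ⊗ₖ E) *ᵥ y.ofLp) (a, e) := by rw [hy]; rfl
  rw [this, WithLp.ofLp_sum, Matrix.mulVec_sum, Finset.sum_apply]
  simp only [Matrix.mulVec, dotProduct, Fintype.sum_prod_type, Matrix.kronecker_apply, sndSlice,
    WithLp.ofLp_smul, Pi.smul_apply, smul_eq_mul]
  exact Finset.sum_congr rfl fun a _ => Finset.sum_congr rfl fun e _ => by ring

/-- The kernel component of `a ⊗ e`, in terms of the range and kernel components of the
factors. -/
theorem kerPart_kronVec {A : Matrix ι ι ℝ} {E : Matrix κ κ ℝ} (hA : Aᵀ = A) (hE : Eᵀ = E)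
    (a : EuclideanSpace ℝ ι) (e : EuclideanSpace ℝ κ) :
    kerPart (A ⊗ₖ E) (kronVec a e)
      = kronVec ((rangeOf A).starProjection a) (perpPart E e)
        + kronVec (perpPart A a) ((rangeOf E).starProjection e)
        + kronVec (perpPart A a) (perpPart E e) := by
  have ha : a = (rangeOf A).starProjection a + perpPart A a :=
    (Submodule.starProjection_add_starProjection_orthogonal a).symm
  have he : e = (rangeOf E).starProjection e + perpPart E e :=
    (Submodule.starProjection_add_starProjection_orthogonal e).symm
  have haK : A *ᵥ (perpPart A a).ofLp = 0 := mem_kerOf.mp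
    (mem_kerOf_of_mem_rangeOf_orthogonal hA (Submodule.starProjection_apply_mem _ _))
  have heK : E *ᵥ (perpPart E e).ofLp = 0 := mem_kerOf.mp
    (mem_kerOf_of_mem_rangeOf_orthogonal hE (Submodule.starProjection_apply_mem _ _))
  -- What remains is the tensor of the two range components; it lies in the range of `A ⊗ E`, hence
  -- is orthogonal to the kernel.
  have hsplit : kronVec a e - (kronVec ((rangeOf A).starProjection a) (perpPart E e)
        + kronVec (perpPart A a) ((rangeOf E).starProjection e)
        + kronVec (perpPart A a) (perpPart E e))
      = kronVec ((rangeOf A).starProjection a) ((rangeOf E).starProjection e) := by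
    conv_lhs => enter [1]; rw [ha, he]
    ext p
    simp only [kronVec, WithLp.ofLp_sub, WithLp.ofLp_add, Pi.sub_apply, Pi.add_apply]
    ring
  refine Submodule.eq_starProjection_of_mem_of_inner_eq_zero ?_ ?_
  · rw [mem_kerOf]
    funext ⟨i, j⟩
    simp only [WithLp.ofLp_add, Matrix.mulVec_add, Pi.add_apply, kronecker_mulVec_kronVec, haK,
      heK, Pi.zero_apply, mul_zero, zero_mul, add_zero]
  · intro w hw
    rw [hsplit]
    refine inner_eq_zero_of_mem_rangeOf_of_mem_kerOf ?_ ?_ hw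
    · rw [← Matrix.kroneckerMap_transpose, hA, hE]
    · obtain ⟨y, hy⟩ := mem_rangeOf.mp (Submodule.starProjection_apply_mem (rangeOf A) a)
      obtain ⟨z, hz⟩ := mem_rangeOf.mp (Submodule.starProjection_apply_mem (rangeOf E) e)
      refine mem_rangeOf.mpr ⟨kronVec y z, ?_⟩
      funext ⟨i, j⟩
      rw [kronecker_mulVec_kronVec, hy, hz]
      rfl

/-- Pythagoras: in each pair of terms of `kerPart_kronVec`, one factor meets a range component with
an orthogonal one. -/
theorem norm_kerPart_kronVec_sq {A : Matrix ι ι ℝ} {E : Matrix κ κ ℝ} (hA : Aᵀ = A) (hE : Eᵀ = E)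
    (a : EuclideanSpace ℝ ι) (e : EuclideanSpace ℝ κ) :
    ‖kerPart (A ⊗ₖ E) (kronVec a e)‖ ^ 2
      = (‖(rangeOf A).starProjection a‖ * ‖perpPart E e‖) ^ 2
        + (‖perpPart A a‖ * ‖(rangeOf E).starProjection e‖) ^ 2
        + (‖perpPart A a‖ * ‖perpPart E e‖) ^ 2 := by
  have h1 : inner ℝ ((rangeOf A).starProjection a) (perpPart A a) = 0 :=
    (Submodule.mem_orthogonal _ _).mp (Submodule.starProjection_apply_mem _ _) _
      (Submodule.starProjection_apply_mem _ _)
  have h2 : inner ℝ ((rangeOf E).starProjection e) (perpPart E e) = 0 :=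
    (Submodule.mem_orthogonal _ _).mp (Submodule.starProjection_apply_mem _ _) _
      (Submodule.starProjection_apply_mem _ _)
  rw [kerPart_kronVec hA hE, norm_add_sq_real, norm_add_sq_real]
  simp only [inner_add_left, inner_kronVec, h1, h2, norm_kronVec_sq]
  ring

end RangeKer

/-! ### Positive semidefinite forms -/

section PosSemidef

open scoped MatrixOrder in
theorem exists_eq_transpose_mul_self {ι : Type*} [Fintype ι] [DecidableEq ι] {F : Matrix ι ι ℝ}
    (hF : F.PosSemidef) : ∃ G : Matrix ι ι ℝ, F = Gᵀ * G := by
  obtain ⟨G, hG⟩ := CStarAlgebra.nonneg_iff_eq_star_mul_self.mp hF.nonneg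
  exact ⟨G, by rw [hG, Matrix.star_eq_conjTranspose,
    Matrix.conjTranspose_eq_transpose_of_trivial]⟩

theorem dotProduct_sq_le {κ : Type*} [Fintype κ] (x y : κ → ℝ) :
    (x ⬝ᵥ y) ^ 2 ≤ (x ⬝ᵥ x) * (y ⬝ᵥ y) := by
  simpa only [dotProduct, sq] using Finset.sum_mul_sq_le_sq_mul_sq Finset.univ x y

theorem zero_le_dotProduct_self {κ : Type*} [Fintype κ] (x : κ → ℝ) : 0 ≤ x ⬝ᵥ x :=
  Finset.sum_nonneg fun i _ => mul_self_nonneg (x i)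

theorem mulVec_dotProduct_eq {ι κ : Type*} [Fintype ι] [Fintype κ] (P : Matrix κ ι ℝ)
    (u : ι → ℝ) (w : κ → ℝ) : (P *ᵥ u) ⬝ᵥ w = u ⬝ᵥ (Pᵀ *ᵥ w) := by
  rw [Matrix.dotProduct_mulVec u Pᵀ w, Matrix.vecMul_transpose]

theorem transpose_eq_of_posSemidef {ι : Type*} {F : Matrix ι ι ℝ} (hF : F.PosSemidef) : Fᵀ = F := by
  have := hF.isHermitian
  rwa [Matrix.IsHermitian, Matrix.conjTranspose_eq_transpose_of_trivial] at this

variable {ι : Type*} [Fintype ι] [DecidableEq ι]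

theorem specNorm_nonneg (F : Matrix ι ι ℝ) : 0 ≤ specNorm F := norm_nonneg _

theorem dotProduct_mulVec_self_le_specNorm (F : Matrix ι ι ℝ) (y : EuclideanSpace ℝ ι) :
    y.ofLp ⬝ᵥ (F *ᵥ y.ofLp) ≤ specNorm F * ‖y‖ ^ 2 := by
  have h := (real_inner_le_norm y (Matrix.toEuclideanCLM (n := ι) (𝕜 := ℝ) F y)).trans
    (mul_le_mul_of_nonneg_left (ContinuousLinearMap.le_opNorm _ y) (norm_nonneg y))
  rw [inner_eq_dotProduct] at h
  refine h.trans (le_of_eq ?_)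
  rw [specNorm]
  ring

/-- `‖F x‖² ≤ ‖F‖ ⟪x, F x⟫` for positive semidefinite `F`. -/
theorem norm_mulVec_sq_le_specNorm_mul {F : Matrix ι ι ℝ} (hF : F.PosSemidef)
    (x : EuclideanSpace ℝ ι) {y : EuclideanSpace ℝ ι} (hy : y.ofLp = F *ᵥ x.ofLp) :
    ‖y‖ ^ 2 ≤ specNorm F * (x.ofLp ⬝ᵥ y.ofLp) := by
  obtain ⟨G, hG⟩ := exists_eq_transpose_mul_self hF
  have hform : ∀ u v : ι → ℝ, u ⬝ᵥ (F *ᵥ v) = (G *ᵥ u) ⬝ᵥ (G *ᵥ v) := by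
    intro u v
    rw [hG, ← Matrix.mulVec_mulVec, Matrix.dotProduct_mulVec, Matrix.vecMul_transpose]
  -- Cauchy–Schwarz for the semi-inner product of `F`, in which `‖y‖²` pairs `y` with `x`.
  have h1 : (‖y‖ ^ 2) ^ 2 ≤ (x.ofLp ⬝ᵥ y.ofLp) * (y.ofLp ⬝ᵥ (F *ᵥ y.ofLp)) := by
    rw [← dotProduct_self_eq_norm_sq]
    conv_lhs => enter [1, 2]; rw [hy]
    conv_rhs => enter [1]; rw [hy]
    rw [hform, hform, hform, mul_comm]
    exact dotProduct_sq_le _ _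
  have hq : 0 ≤ x.ofLp ⬝ᵥ y.ofLp := by
    rw [hy, hform]
    exact zero_le_dotProduct_self _
  have h2 := h1.trans (mul_le_mul_of_nonneg_left (dotProduct_mulVec_self_le_specNorm F y) hq)
  rcases (sq_nonneg ‖y‖).eq_or_lt with h0 | h0
  · rw [← h0]
    exact mul_nonneg (specNorm_nonneg F) hq
  · nlinarith

/-- Every vector in the range of `F` has a preimage whose norm is at most `‖g‖ / λ_min⁺(F)`. -/
theorem exists_preimage_norm_le {F : Matrix ι ι ℝ} (hF : F.PosSemidef)
    {g : EuclideanSpace ℝ ι} (hg : g ∈ rangeOf F) :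
    ∃ h : EuclideanSpace ℝ ι, F *ᵥ h.ofLp = g.ofLp ∧ ‖h‖ ≤ ‖g‖ / lamMinPos F := by
  rcases eq_or_ne g 0 with rfl | hg0
  · exact ⟨0, by simp, by simp⟩
  have hFT := transpose_eq_of_posSemidef hF
  obtain ⟨h₀, hh₀⟩ := mem_rangeOf.mp hg
  -- Projecting removes the components of the preimage along eigenvectors of eigenvalue zero, which
  -- `g` does not control.
  set h := (rangeOf F).starProjection h₀ with hh
  have hn : F *ᵥ (h₀ - h).ofLp = 0 := mem_kerOf.mp (mem_kerOf_of_mem_rangeOf_orthogonal hFT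
    (Submodule.sub_starProjection_mem_orthogonal h₀))
  have hFh : F *ᵥ h.ofLp = g.ofLp := by
    rw [WithLp.ofLp_sub, Matrix.mulVec_sub, sub_eq_zero] at hn
    rw [← hn, hh₀]
  obtain ⟨w, hw⟩ := mem_rangeOf.mp (Submodule.starProjection_apply_mem (rangeOf F) h₀)
  have hH := hF.isHermitian
  set b := hH.eigenvectorBasis
  set l := hH.eigenvalues
  have hb : ∀ (i : ι) (x z : EuclideanSpace ℝ ι), F *ᵥ x.ofLp = z.ofLp →
      inner ℝ (b i) z = l i * inner ℝ (b i) x := by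
    intro i x z hxz
    rw [inner_eq_dotProduct, inner_eq_dotProduct, ← hxz, Matrix.dotProduct_mulVec,
      ← Matrix.mulVec_transpose, hFT, hH.mulVec_eigenvectorBasis, smul_dotProduct, smul_eq_mul]
  set T := {x : ℝ | x ≠ 0 ∧ Module.End.HasEigenvalue (Matrix.toEuclideanLin F) x} with hT
  have hTfin : T.Finite := (Module.End.finite_hasEigenvalue _).subset fun x hx => hx.2
  have hTl : ∀ i, l i ≠ 0 → l i ∈ T := by
    intro i hi
    refine ⟨hi, Module.End.hasEigenvalue_of_hasEigenvector (x := b i) ⟨?_, ?_⟩⟩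
    · rw [Module.End.mem_eigenspace_iff]
      exact (WithLp.ofLp_injective 2) (hH.mulVec_eigenvectorBasis i)
    · exact b.toBasis.ne_zero i |> fun h => by simpa using h
  have hTpos : ∀ x ∈ T, 0 < x := by
    rintro x ⟨hx0, hx⟩
    obtain ⟨v, hv⟩ := hx.exists_hasEigenvector
    have h1 : F *ᵥ v.ofLp = x • v.ofLp := congrArg WithLp.ofLp hv.apply_eq_smul
    have h2 := hF.dotProduct_mulVec_nonneg v.ofLp
    rw [star_trivial, h1, dotProduct_smul, dotProduct_self_eq_norm_sq, smul_eq_mul] at h2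
    have h3 : 0 < ‖v‖ ^ 2 := by
      have := norm_pos_iff.mpr hv.2
      positivity
    exact lt_of_le_of_ne (nonneg_of_mul_nonneg_left h2 h3) hx0.symm
  -- Since `g ≠ 0` some eigenvalue is nonzero, so the infimum is attained and positive rather than
  -- the default `sInf ∅ = 0`.
  have hne : T.Nonempty := by
    by_contra hcon
    rw [Set.not_nonempty_iff_eq_empty] at hcon
    apply hg0
    have : ‖g‖ ^ 2 = 0 := by
      rw [← b.sum_sq_norm_inner_right]
      refine Finset.sum_eq_zero fun i _ => ?_
      have hl : l i = 0 := by
        by_contra hi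
        have := hTl i hi
        rw [hcon] at this
        exact this
      rw [hb i h g hFh, hl, zero_mul, norm_zero, sq, zero_mul]
    simpa using this
  have hmem := hne.csInf_mem hTfin
  have hlam : 0 < lamMinPos F := hTpos _ hmem
  refine ⟨h, hFh, ?_⟩
  rw [le_div_iff₀ hlam]
  refine le_of_sq_le_sq ?_ (norm_nonneg g)
  rw [mul_pow, ← b.sum_sq_norm_inner_right h, ← b.sum_sq_norm_inner_right g, Finset.sum_mul]
  refine Finset.sum_le_sum fun i _ => ?_
  rw [hb i h g hFh]
  by_cases hi : l i = 0
  · rw [hb i w h hw, hi]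
    simp
  · have h1 : lamMinPos F ≤ l i := csInf_le hTfin.bddBelow (hTl i hi)
    rw [norm_mul, mul_pow, mul_comm, Real.norm_eq_abs (l i), sq_abs]
    gcongr

end PosSemidef

/-! ### Sketched influence for a sketch that embeds the range of `F` -/

section Influence

variable {ι κ : Type*} [Fintype ι] [Fintype κ] [DecidableEq ι]

/-- `M M†` fixes the range of `P F` if `M = P F Pᵀ`. -/
theorem mul_pinv_mul_of_posSemidef {F : Matrix ι ι ℝ} (hF : F.PosSemidef) (P : Matrix κ ι ℝ)
    {M : Matrix κ κ ℝ} (hM : M = P * F * Pᵀ) : M * pinv M * (P * F) = P * F := by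
  obtain ⟨G, hG⟩ := exists_eq_transpose_mul_self hF
  obtain ⟨B, hB⟩ : ∃ B, B = P * Gᵀ := ⟨_, rfl⟩
  have hMB : M = B * Bᵀ := by
    rw [hM, hG, hB, Matrix.transpose_mul, Matrix.transpose_transpose]
    simp only [Matrix.mul_assoc]
  -- `D Bᵀ` vanishes by a Penrose condition; hence `D Dᵀ = 0` and `D = 0`.
  set D := B - M * pinv M * B with hD
  have hDB : D * Bᵀ = 0 := by
    rw [hD, Matrix.sub_mul, Matrix.mul_assoc _ B, ← hMB, (pinv_spec M).mul_mul_self, sub_self]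
  have hDD : D * Dᵀ = 0 := by
    conv_lhs => enter [2]; rw [hD]
    rw [Matrix.transpose_sub, Matrix.transpose_mul _ B, Matrix.mul_sub, ← Matrix.mul_assoc, hDB,
      Matrix.zero_mul, sub_zero]
  rw [← Matrix.conjTranspose_eq_transpose_of_trivial,
    Matrix.self_mul_conjTranspose_eq_zero] at hDD
  have hfix : M * pinv M * B = B := (sub_eq_zero.mp hDD).symm
  have hPF : P * F = B * G := by rw [hG, hB, Matrix.mul_assoc]
  rw [hPF, ← Matrix.mul_assoc, hfix]

variable [DecidableEq κ] {F : Matrix ι ι ℝ} {P : Matrix κ ι ℝ} {g' : EuclideanSpace ℝ ι} {ε : ℝ}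

/-- `P y` is the orthogonal projection `M M† P g'`, so `‖P y‖² = ⟪P y, P g'⟫`. The lower embedding
bound and `hcross` then give `‖y‖ ≤ ε ‖g'‖`, while the influence is `⟪h, y⟫` for a short preimage
`h` of `g`. -/
theorem abs_sketchedInfluence_zero_le (hF : F.PosSemidef) (hε : 0 < ε)
    (hcross : ∀ x ∈ rangeOf F, |(P *ᵥ x.ofLp) ⬝ᵥ (P *ᵥ g'.ofLp)| ≤ ε / 2 * ‖x‖ * ‖g'‖)
    (hlow : ∀ x ∈ rangeOf F, 1 / 2 * ‖x‖ ^ 2 ≤ (P *ᵥ x.ofLp) ⬝ᵥ (P *ᵥ x.ofLp))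
    {g : EuclideanSpace ℝ ι} (hg : g ∈ rangeOf F) :
    |sketchedInfluence F P 0 g g'| ≤ ε * ‖g‖ * ‖g'‖ / lamMinPos F := by
  have hFT := transpose_eq_of_posSemidef hF
  obtain ⟨h, hh, hnorm⟩ := exists_preimage_norm_le hF hg
  rw [sketchedInfluence, zero_smul, add_zero]
  set M := P * F * Pᵀ with hM
  set w := pinv M *ᵥ (P *ᵥ g'.ofLp) with hw
  set y : EuclideanSpace ℝ ι := WithLp.toLp 2 (F *ᵥ (Pᵀ *ᵥ w)) with hy
  have hyF : y ∈ rangeOf F := mem_rangeOf.mpr ⟨WithLp.toLp 2 (Pᵀ *ᵥ w), rfl⟩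
  have hPyw : P *ᵥ y.ofLp = (P * F) *ᵥ (Pᵀ *ᵥ w) := by rw [hy, Matrix.mulVec_mulVec]
  have hPy : P *ᵥ y.ofLp = (M * pinv M) *ᵥ (P *ᵥ g'.ofLp) := by
    rw [← Matrix.mulVec_mulVec, ← hw, hPyw, hM, Matrix.mulVec_mulVec]
  have hself : (P *ᵥ y.ofLp) ⬝ᵥ (P *ᵥ y.ofLp) = (P *ᵥ y.ofLp) ⬝ᵥ (P *ᵥ g'.ofLp) := by
    conv_lhs => enter [2]; rw [hPy]
    rw [Matrix.dotProduct_mulVec, ← Matrix.mulVec_transpose, (pinv_spec M).left_symm]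
    congr 1
    rw [hPyw, Matrix.mulVec_mulVec _ (M * pinv M), mul_pinv_mul_of_posSemidef hF P hM]
  have hyn : ‖y‖ ≤ ε * ‖g'‖ := by
    have h1 := hlow y hyF
    have h2 := (le_abs_self _).trans (hcross y hyF)
    rw [hself] at h1
    rcases (norm_nonneg y).eq_or_lt with h0 | h0
    · rw [← h0]; positivity
    · nlinarith
  have hval : (P *ᵥ g.ofLp) ⬝ᵥ w = inner ℝ h y := by
    rw [inner_eq_dotProduct, mulVec_dotProduct_eq, ← hh, mulVec_dotProduct_eq, hFT]
  rw [hval]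
  calc |inner ℝ h y| ≤ ‖h‖ * ‖y‖ := abs_real_inner_le_norm h y
    _ ≤ ‖g‖ / lamMinPos F * (ε * ‖g'‖) :=
        mul_le_mul hnorm hyn (norm_nonneg _) ((norm_nonneg h).trans hnorm)
    _ = _ := by ring

/-- The equation `P y + lam w = P g'` is tested twice. Against `P y`, dropping `‖P y‖²` and using
`‖y‖² ≤ ‖F‖ ⟪x, y⟫` bounds `lam ‖y‖`; against `P g` it bounds the influence by a cross term plus `2
‖g‖ ‖y‖`. Only an upper embedding bound is needed. -/
theorem abs_sketchedInfluence_le (hF : F.PosSemidef) (hε : 0 < ε)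
    (hcross : ∀ x ∈ rangeOf F, |(P *ᵥ x.ofLp) ⬝ᵥ (P *ᵥ g'.ofLp)| ≤ ε / 2 * ‖x‖ * ‖g'‖)
    (hupp : ∀ x ∈ rangeOf F, (P *ᵥ x.ofLp) ⬝ᵥ (P *ᵥ x.ofLp) ≤ 2 * ‖x‖ ^ 2)
    {g : EuclideanSpace ℝ ι} (hg : g ∈ rangeOf F) {lam : ℝ} (hlam : 0 < lam) :
    |sketchedInfluence F P lam g g'|
      ≤ ε * ‖g‖ * ‖g'‖ * (1 / lam + 2 * specNorm F / lam ^ 2) := by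
  rw [sketchedInfluence]
  set M := P * F * Pᵀ + lam • (1 : Matrix κ κ ℝ) with hM
  have hMpos : M.PosDef := by
    have h := hF.mul_mul_conjTranspose_same P
    rw [Matrix.conjTranspose_eq_transpose_of_trivial] at h
    exact Matrix.PosDef.posSemidef_add h (Matrix.PosDef.one.smul hlam)
  have hdet : IsUnit M.det := (Matrix.isUnit_iff_isUnit_det M).mp hMpos.isUnit
  set w := pinv M *ᵥ (P *ᵥ g'.ofLp) with hw
  set x : EuclideanSpace ℝ ι := WithLp.toLp 2 (Pᵀ *ᵥ w) with hx
  set y : EuclideanSpace ℝ ι := WithLp.toLp 2 (F *ᵥ x.ofLp) with hy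
  have hyF : y ∈ rangeOf F := mem_rangeOf.mpr ⟨x, rfl⟩
  have hMw : P *ᵥ y.ofLp + lam • w = P *ᵥ g'.ofLp := by
    have h1 : M *ᵥ w = P *ᵥ g'.ofLp := by
      rw [hw, pinv_eq_inv M hdet, Matrix.mulVec_mulVec, Matrix.mul_nonsing_inv M hdet,
        Matrix.one_mulVec]
    rw [← h1, hM, Matrix.add_mulVec, Matrix.smul_mulVec, Matrix.one_mulVec, hy, hx,
      Matrix.mulVec_mulVec, Matrix.mulVec_mulVec, Matrix.mul_assoc]
  have hPw : ∀ z : EuclideanSpace ℝ ι, (P *ᵥ z.ofLp) ⬝ᵥ w = z.ofLp ⬝ᵥ x.ofLp :=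
    fun z => mulVec_dotProduct_eq P z.ofLp w
  have hdot : ∀ z : EuclideanSpace ℝ ι, lam * (z.ofLp ⬝ᵥ x.ofLp)
      = (P *ᵥ z.ofLp) ⬝ᵥ (P *ᵥ g'.ofLp) - (P *ᵥ z.ofLp) ⬝ᵥ (P *ᵥ y.ofLp) := by
    intro z
    rw [← hMw, dotProduct_add, dotProduct_smul, hPw, smul_eq_mul]
    ring
  have hs := specNorm_nonneg F
  have hyn : lam * ‖y‖ ≤ specNorm F * (ε / 2 * ‖g'‖) := by
    have h1 : lam * (y.ofLp ⬝ᵥ x.ofLp) ≤ ε / 2 * ‖y‖ * ‖g'‖ := by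
      rw [hdot y]
      have := (le_abs_self _).trans (hcross y hyF)
      have := zero_le_dotProduct_self (P *ᵥ y.ofLp)
      linarith
    have h2 := norm_mulVec_sq_le_specNorm_mul hF x (y := y) rfl
    rw [dotProduct_comm] at h2
    rcases (norm_nonneg y).eq_or_lt with h0 | h0
    · rw [← h0, mul_zero]; positivity
    · refine le_of_mul_le_mul_right ?_ h0
      nlinarith [mul_le_mul_of_nonneg_left h2 hlam.le, mul_le_mul_of_nonneg_left h1 hs]
  have hgy : |(P *ᵥ g.ofLp) ⬝ᵥ (P *ᵥ y.ofLp)| ≤ 2 * ‖g‖ * ‖y‖ := by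
    refine abs_le_of_sq_le_sq ?_ (by positivity)
    refine (dotProduct_sq_le _ _).trans ?_
    calc _ ≤ (2 * ‖g‖ ^ 2) * (2 * ‖y‖ ^ 2) :=
          mul_le_mul (hupp g hg) (hupp y hyF) (zero_le_dotProduct_self _) (by positivity)
      _ = _ := by ring
  have hmain : lam * |g.ofLp ⬝ᵥ x.ofLp| ≤ ε / 2 * ‖g‖ * ‖g'‖ + 2 * ‖g‖ * ‖y‖ := by
    have h1 : lam * |g.ofLp ⬝ᵥ x.ofLp| = |lam * (g.ofLp ⬝ᵥ x.ofLp)| := by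
      rw [abs_mul, abs_of_pos hlam]
    rw [h1, hdot g]
    exact (abs_sub _ _).trans (add_le_add (hcross g hg) hgy)
  rw [hPw]
  have hfin : lam ^ 2 * |g.ofLp ⬝ᵥ x.ofLp|
      ≤ ε * ‖g‖ * ‖g'‖ * (lam + 2 * specNorm F) := by
    have h1 := mul_le_mul_of_nonneg_left hmain hlam.le
    have h2 := mul_le_mul_of_nonneg_left hyn (show 0 ≤ 2 * ‖g‖ by positivity)
    have h3 : 0 ≤ ε * ‖g‖ * ‖g'‖ * lam := by positivity
    have h4 : 0 ≤ ε * ‖g‖ * ‖g'‖ * specNorm F := by positivity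
    linarith
  have heq : ε * ‖g‖ * ‖g'‖ * (1 / lam + 2 * specNorm F / lam ^ 2)
      = ε * ‖g‖ * ‖g'‖ * (lam + 2 * specNorm F) / lam ^ 2 := by
    field_simp
  rw [heq, le_div_iff₀ (by positivity), mul_comm]
  exact hfin

end Influence

/-! ### Deterministic bounds for a Kronecker product of embeddings -/

section KroneckerEmbedding

variable {ι κ μ ν : Type*} [Fintype ι] [Fintype κ] [Fintype μ] [Fintype ν]

theorem PreservesInner.norm_sq_le {P : Matrix μ ι ℝ} {η : ℝ} {x : EuclideanSpace ℝ ι}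
    (h : PreservesInner P η x x) :
    (P *ᵥ x.ofLp) ⬝ᵥ (P *ᵥ x.ofLp) ≤ (1 + η) * ‖x‖ ^ 2 := by
  rw [PreservesInner, real_inner_self_eq_norm_sq] at h
  linarith [(abs_le.mp h).2]

theorem PreservesInner.le_norm_sq {P : Matrix μ ι ℝ} {η : ℝ} {x : EuclideanSpace ℝ ι}
    (h : PreservesInner P η x x) :
    (1 - η) * ‖x‖ ^ 2 ≤ (P *ᵥ x.ofLp) ⬝ᵥ (P *ᵥ x.ofLp) := by
  rw [PreservesInner, real_inner_self_eq_norm_sq] at h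
  linarith [(abs_le.mp h).1]

theorem PreservesInner.abs_dotProduct_le {P : Matrix μ ι ℝ} {η : ℝ} {x y : EuclideanSpace ℝ ι}
    (h : PreservesInner P η x y) :
    |(P *ᵥ x.ofLp) ⬝ᵥ (P *ᵥ y.ofLp)| ≤ (1 + η) * ‖x‖ * ‖y‖ := by
  have h1 := abs_real_inner_le_norm x y
  rw [PreservesInner] at h
  have h2 := abs_sub_abs_le_abs_sub ((P *ᵥ x.ofLp) ⬝ᵥ (P *ᵥ y.ofLp)) (inner ℝ x y)
  linarith

theorem PreservesInner.abs_dotProduct_le_of_inner_eq_zero {P : Matrix μ ι ℝ} {η : ℝ}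
    {x y : EuclideanSpace ℝ ι} (h : PreservesInner P η x y) (hxy : inner ℝ x y = 0) :
    |(P *ᵥ x.ofLp) ⬝ᵥ (P *ᵥ y.ofLp)| ≤ η * ‖x‖ * ‖y‖ := by
  rwa [PreservesInner, hxy, sub_zero] at h

theorem sketchedInfluence_zero_left [DecidableEq κ] (F : Matrix ι ι ℝ) (P : Matrix κ ι ℝ) (lam : ℝ)
    (g' : EuclideanSpace ℝ ι) : sketchedInfluence F P lam 0 g' = 0 := by
  simp [sketchedInfluence]

variable [DecidableEq ι] [DecidableEq κ]

theorem inner_perpPart_eq_zero {M : Matrix ι ι ℝ} {x : EuclideanSpace ℝ ι} (hx : x ∈ rangeOf M)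
    (v : EuclideanSpace ℝ ι) : inner ℝ x (perpPart M v) = 0 :=
  (Submodule.mem_orthogonal _ _).mp (Submodule.starProjection_apply_mem _ _) _ hx

/-- Each of the three tensors has an out-of-range factor contributing `ε / 8`; the other contributes
at most `1 + ε / 8 ≤ 9 / 8`. This gives `9 ε / 64` per term, and the norms sum to at most twice the
total norm. -/
theorem abs_kronecker_dotProduct_kerPart_le {A : Matrix ι ι ℝ} {E : Matrix κ κ ℝ}
    (hA : Aᵀ = A) (hE : Eᵀ = E) {P : Matrix μ ι ℝ} {Q : Matrix ν κ ℝ} {ε : ℝ}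
    (hε : 0 < ε) (hε1 : ε < 1)
    (hP : ∀ x ∈ rangeOf A, ∀ y ∈ rangeOf A, PreservesInner P (ε / 8) x y)
    (hQ : ∀ x ∈ rangeOf E, ∀ y ∈ rangeOf E, PreservesInner Q (ε / 8) x y)
    {a : EuclideanSpace ℝ ι} {e : EuclideanSpace ℝ κ}
    (hPa : ∀ x ∈ rangeOf A, PreservesInner P (ε / 8) x (perpPart A a))
    (hQe : ∀ x ∈ rangeOf E, PreservesInner Q (ε / 8) x (perpPart E e))
    {x : EuclideanSpace ℝ (ι × κ)} (hx : x ∈ rangeOf (A ⊗ₖ E)) :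
    |((P ⊗ₖ Q) *ᵥ x.ofLp) ⬝ᵥ ((P ⊗ₖ Q) *ᵥ (kerPart (A ⊗ₖ E) (kronVec a e)).ofLp)|
      ≤ ε / 2 * ‖x‖ * ‖kerPart (A ⊗ₖ E) (kronVec a e)‖ := by
  have hxS := fstSlice_mem_rangeOf A E hx
  have hxT := sndSlice_mem_rangeOf A E hx
  have hPin := fun y hy => (hP y hy _
    (Submodule.starProjection_apply_mem (rangeOf A) a)).abs_dotProduct_le
  have hQin := fun y hy => (hQ y hy _
    (Submodule.starProjection_apply_mem (rangeOf E) e)).abs_dotProduct_le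
  have hPout := fun y hy =>
    (hPa y hy).abs_dotProduct_le_of_inner_eq_zero (inner_perpPart_eq_zero hy a)
  have hQout := fun y hy =>
    (hQe y hy).abs_dotProduct_le_of_inner_eq_zero (inner_perpPart_eq_zero hy e)
  have h1 := abs_kronecker_dotProduct_kronVec_le (by positivity) (by positivity) hPin hQout
    hxS hxT
  have h2 := abs_kronecker_dotProduct_kronVec_le (by positivity) (by positivity) hPout hQin
    hxS hxT
  have h3 := abs_kronecker_dotProduct_kronVec_le (by positivity) (by positivity) hPout hQout
    hxS hxT
  have hnorm := norm_kerPart_kronVec_sq hA hE a e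
  set p := ‖(rangeOf A).starProjection a‖ * ‖perpPart E e‖ with hp
  set q := ‖perpPart A a‖ * ‖(rangeOf E).starProjection e‖ with hq
  set s := ‖perpPart A a‖ * ‖perpPart E e‖ with hs
  set N := ‖kerPart (A ⊗ₖ E) (kronVec a e)‖ with hN
  have hp0 : 0 ≤ p := by positivity
  have hq0 : 0 ≤ q := by positivity
  have hs0 : 0 ≤ s := by positivity
  have hN0 : 0 ≤ N := norm_nonneg _
  -- Orthogonality gives `p² + q² + s² = N²`, so even `√3 N` would do.
  have hsum : p + q + s ≤ 2 * N := by
    refine le_of_sq_le_sq ?_ (by positivity)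
    nlinarith [sq_nonneg (p - q), sq_nonneg (p - s), sq_nonneg (q - s), sq_nonneg N]
  have hc1 : (1 + ε / 8) * (ε / 8) ≤ 9 / 64 * ε := by nlinarith
  have hc2 : ε / 8 * (ε / 8) ≤ 9 / 64 * ε := by nlinarith
  have hx0 := norm_nonneg x
  have h1' := h1.trans (mul_le_mul_of_nonneg_right (mul_le_mul_of_nonneg_right hc1 hx0) hp0)
  have h2' := h2.trans (mul_le_mul_of_nonneg_right (mul_le_mul_of_nonneg_right
    ((mul_comm _ _).trans_le hc1) hx0) hq0)
  have h3' := h3.trans (mul_le_mul_of_nonneg_right (mul_le_mul_of_nonneg_right hc2 hx0) hs0)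
  rw [kerPart_kronVec hA hE]
  simp only [WithLp.ofLp_add, Matrix.mulVec_add, dotProduct_add]
  refine (abs_add_three _ _ _).trans ((add_le_add (add_le_add h1' h2') h3').trans ?_)
  have h4 := mul_le_mul_of_nonneg_left hsum (show 0 ≤ 9 / 64 * ε * ‖x‖ by positivity)
  have h5 : 0 ≤ ε * ‖x‖ * N := by positivity
  linarith

theorem kronecker_norm_sq_bounds {A : Matrix ι ι ℝ} {E : Matrix κ κ ℝ}
    {P : Matrix μ ι ℝ} {Q : Matrix ν κ ℝ} {η : ℝ} (hη : 0 ≤ η) (hη1 : η ≤ 1 / 8)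
    (hP : ∀ x ∈ rangeOf A, ∀ y ∈ rangeOf A, PreservesInner P η x y)
    (hQ : ∀ x ∈ rangeOf E, ∀ y ∈ rangeOf E, PreservesInner Q η x y)
    {x : EuclideanSpace ℝ (ι × κ)} (hx : x ∈ rangeOf (A ⊗ₖ E)) :
    1 / 2 * ‖x‖ ^ 2 ≤ ((P ⊗ₖ Q) *ᵥ x.ofLp) ⬝ᵥ ((P ⊗ₖ Q) *ᵥ x.ofLp) ∧
      ((P ⊗ₖ Q) *ᵥ x.ofLp) ⬝ᵥ ((P ⊗ₖ Q) *ᵥ x.ofLp) ≤ 2 * ‖x‖ ^ 2 := by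
  have hxS := fstSlice_mem_rangeOf A E hx
  have hxT := sndSlice_mem_rangeOf A E hx
  have h1 := le_kronecker_norm_sq (by linarith) (fun y hy => (hP y hy y hy).le_norm_sq)
    (fun y hy => (hQ y hy y hy).le_norm_sq) hxS hxT
  have h2 := kronecker_norm_sq_le (by linarith) (fun y hy => (hP y hy y hy).norm_sq_le)
    (fun y hy => (hQ y hy y hy).norm_sq_le) hxS hxT
  exact ⟨(mul_le_mul_of_nonneg_right (by nlinarith) (sq_nonneg _)).trans h1,
    h2.trans (mul_le_mul_of_nonneg_right (by nlinarith) (sq_nonneg _))⟩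

theorem eq_zero_of_mem_rangeOf_of_rank_eq_zero {A : Matrix ι ι ℝ} {E : Matrix κ κ ℝ}
    (h : A.rank = 0 ∨ E.rank = 0) {g : EuclideanSpace ℝ (ι × κ)}
    (hg : g ∈ rangeOf (A ⊗ₖ E)) : g = 0 := by
  ext p
  rcases h with h | h
  · rw [← finrank_rangeOf, Submodule.finrank_eq_zero] at h
    have h1 := fstSlice_mem_rangeOf A E hg p.2
    rw [h, Submodule.mem_bot] at h1
    exact congrArg (fun v => v.ofLp p.1) h1
  · rw [← finrank_rangeOf, Submodule.finrank_eq_zero] at h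
    have h1 := sndSlice_mem_rangeOf A E hg p.1
    rw [h, Submodule.mem_bot] at h1
    exact congrArg (fun v => v.ofLp p.2) h1

end KroneckerEmbedding

/-! ### The good event and the final theorem -/

theorem exists_measurableSet_compl {Ω : Type*} [MeasurableSpace Ω] (μ : Measure Ω)
    [IsProbabilityMeasure μ] {B : Set Ω} {δ : ℝ} (hδ : 0 ≤ δ) (hB : μ B ≤ ENNReal.ofReal δ) :
    ∃ S : Set Ω, MeasurableSet S ∧ ENNReal.ofReal (1 - δ) ≤ μ S ∧ Disjoint S B := by
  -- `B` is not assumed measurable; its measurable hull has the same measure.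
  refine ⟨(toMeasurable μ B)ᶜ, (measurableSet_toMeasurable _ _).compl, ?_, ?_⟩
  · rw [prob_compl_eq_one_sub (measurableSet_toMeasurable _ _), measure_toMeasurable,
      ENNReal.ofReal_sub _ hδ, ENNReal.ofReal_one]
    exact tsub_le_tsub_left hB 1
  · exact Set.disjoint_left.mpr fun ω hω hωB => hω (subset_toMeasurable μ B hωB)

end KronInfluence

theorem theorem7 (σsq : ℝ≥0) :
    ∃ C : ℝ, 0 < C ∧
      ∀ {Ω : Type*} [MeasurableSpace Ω] (μ : Measure Ω) [IsProbabilityMeasure μ]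
        (dA dE mA mE k : ℕ)
        (A : Matrix (Fin dA) (Fin dA) ℝ) (E : Matrix (Fin dE) (Fin dE) ℝ)
        (F : Matrix (Fin dA × Fin dE) (Fin dA × Fin dE) ℝ)
        (_ : A.PosSemidef) (_ : E.PosSemidef) (_ : F = A ⊗ₖ E)
        (WA : Fin mA → Ω → EuclideanSpace ℝ (Fin dA))
        (WE : Fin mE → Ω → EuclideanSpace ℝ (Fin dE))
        (P : Ω → Matrix (Fin mA × Fin mE) (Fin dA × Fin dE) ℝ)
        (_ : IsSubGaussianRows σsq WA μ) (_ : IsSubGaussianRows σsq WE μ)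
        (_ : ∀ ω, P ω = sketchMatrix WA ω ⊗ₖ sketchMatrix WE ω)
        (a : Fin k → EuclideanSpace ℝ (Fin dA)) (e : Fin k → EuclideanSpace ℝ (Fin dE))
        (ε δ : ℝ) (_ : 0 < ε) (_ : ε < 1) (_ : 0 < δ) (_ : δ < 1)
        (_ : C * (sketchComplexity A a δ / ε ^ 2) ≤ (mA : ℝ))
        (_ : C * (sketchComplexity E e δ / ε ^ 2) ≤ (mE : ℝ)),
        ∃ S : Set Ω, MeasurableSet S ∧ ENNReal.ofReal (1 - δ) ≤ μ S ∧
          ∀ ω ∈ S, ∀ g ∈ rangeOf F, ∀ j : Fin k,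
            |sketchedInfluence F (P ω) 0 g (kerPart F (kronVec (a j) (e j)))|
              ≤ ε * ‖g‖ * ‖kerPart F (kronVec (a j) (e j))‖ / lamMinPos F ∧
            ∀ lam : ℝ, 0 < lam →
              |sketchedInfluence F (P ω) lam g (kerPart F (kronVec (a j) (e j)))|
                ≤ ε * ‖g‖ * ‖kerPart F (kronVec (a j) (e j))‖
                  * (1 / lam + 2 * specNorm F / lam ^ 2) := by
  obtain ⟨C, hC, hemb⟩ := exists_factor_embedding σsq
  refine ⟨C, hC, ?_⟩
  intro Ω _ μ _ dA dE mA mE k A E F hA hE hF WA WE P hWA hWE hP a e ε δ hε hε1 hδ hδ1 hmA hmE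
  subst hF
  -- The factor embedding requires positive rank. Otherwise the range of `F` is zero and both bounds
  -- read `0 ≤ 0`.
  by_cases hrank : A.rank = 0 ∨ E.rank = 0
  · refine ⟨Set.univ, MeasurableSet.univ, ?_, ?_⟩
    · rw [measure_univ]
      exact ENNReal.ofReal_le_one.mpr (by linarith)
    · intro ω _ g hg j
      rw [eq_zero_of_mem_rangeOf_of_rank_eq_zero hrank hg]
      simp [sketchedInfluence_zero_left]
  · rw [not_or] at hrank
    have hbA := hemb μ WA hWA A a ε δ hε hε1 hδ hδ1 (Nat.one_le_iff_ne_zero.mpr hrank.1) hmA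
    have hbE := hemb μ WE hWE E e ε δ hε hε1 hδ hδ1 (Nat.one_le_iff_ne_zero.mpr hrank.2) hmE
    have hunion := (measure_union_le _ _).trans (add_le_add hbA hbE)
    rw [← ENNReal.ofReal_add (by positivity) (by positivity), add_halves] at hunion
    obtain ⟨S, hS, hSμ, hdisj⟩ := exists_measurableSet_compl μ hδ.le hunion
    refine ⟨S, hS, hSμ, fun ω hω g hg j => ?_⟩
    have hgood := Set.disjoint_left.mp hdisj hω
    rw [Set.mem_union, not_or] at hgood
    have hgA := not_not.mp hgood.1
    have hgE := not_not.mp hgood.2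
    have hcross := fun x hx => abs_kronecker_dotProduct_kerPart_le (x := x)
      (transpose_eq_of_posSemidef hA) (transpose_eq_of_posSemidef hE) hε hε1
      (fun x hx => (hgA x hx).1) (fun x hx => (hgE x hx).1)
      (fun x hx => (hgA x hx).2 j) (fun x hx => (hgE x hx).2 j) hx
    have hnorm := fun x hx => kronecker_norm_sq_bounds (x := x) (show 0 ≤ ε / 8 by positivity)
      (by linarith) (fun x hx => (hgA x hx).1) (fun x hx => (hgE x hx).1) hx
    have hFpos := hA.kronecker hE
    rw [hP ω]
    exact ⟨abs_sketchedInfluence_zero_le hFpos hε hcross (fun x hx => (hnorm x hx).1) hg,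
      fun lam hlam =>
        abs_sketchedInfluence_le hFpos hε hcross (fun x hx => (hnorm x hx).2) hg hlam⟩
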